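/- For an integer $k\ge 1$ let $d_k(n)$ be the number of ordered $k$-tuples of positive integers with product $n$, and for $x>0$ put $$\Delta_k(x)=\sum_{n\le x}d_k(n)-\operatorname*{Res}_{s=1}\frac{x^s\zeta^k(s)}{s},$$ where $\zeta$ is the Riemann zeta-function. Let $k\ge 3$ be a fixed integer and let $\sigma(k)$ be a fixed real number with $\frac12\le\sigma(k)<1$ such that, for every $\varepsilon>0$, $$\int_0^T|\zeta(\sigma(k)+it)|^{2k}\,dt\ll_\varepsilon T^{1+\varepsilon}\qquad(T\to\infty).$$ (i) If $\sigma(k)=\frac12$, then for every $\varepsilon>0$ one has $$\int_X^{2X}\bigl(\Delta_k(x+h)-\Delta_k(x)\bigr)^2\,dx\ll_\varepsilon X^{1+\varepsilon}h^{4/3}$$ uniformly for all real $X\ge1$ and $X^\varepsilon\le h\le X^{1-\varepsilon}$, where the implied constant depends only on $k$ and $\varepsilon$. (ii) If $\frac12<\sigma(k)<1$ and $\theta(k)$ is any constant with $2\sigma(k)-1<\theta(k)<1$, then there is an $\varepsilon_1>0$, depending only on $k$, $\sigma(k)$ and $\theta(k)$, such that for every $\varepsilon>0$ one has $$\int_X^{2X}\bigl(\Delta_k(x+h)-\Delta_k(x)\bigr)^2\,dx\ll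 X^{1-\varepsilon_1}h^{2}$$ uniformly for all real $X\ge1$ and $X^{\theta(k)}\le h\le X^{1-\varepsilon}$, where the implied constant depends only on $k$, $\sigma(k)$, $\theta(k)$ and $\varepsilon_1$ (and not on $\varepsilon$). -/

import Mathlib

noncomputable section

open Filter Asymptotics

/-- The generalized divisor function `d_k(n)`: the number of ordered `k`-tuples of positive
integers with product `n` (and `0` for `n = 0`). -/
def divisorFn (k n : ℕ) : ℕ := (Nat.finMulAntidiag k n).card

/-- The residue at `a` of a function with an isolated singularity at `a`: the value of
`(2πi)⁻¹ ∮ f` over small circles `|z - a| = r`, which does not depend on `r` once `r` is small. -/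
def residue (f : ℂ → ℂ) (a : ℂ) : ℂ :=
  limUnder (nhdsWithin (0 : ℝ) (Set.Ioi 0))
    (fun r : ℝ => (2 * (Real.pi : ℂ) * Complex.I)⁻¹ * circleIntegral f a r)

/-- The main term `Res_{s=1} x^s ζ(s)^k / s = x P_{k-1}(log x)`, a real number for `x > 0`. -/
def divisorMainTerm (k : ℕ) (x : ℝ) : ℝ :=
  (residue (fun s : ℂ => (x : ℂ) ^ s * riemannZeta s ^ k / s) 1).re

/-- The error term `Δ_k(x) = ∑_{n ≤ x} d_k(n) - Res_{s=1} x^s ζ(s)^k / s`. -/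
def divisorError (k : ℕ) (x : ℝ) : ℝ :=
  (∑ n ∈ Finset.Icc 1 ⌊x⌋₊, (divisorFn k n : ℝ)) - divisorMainTerm k x

/-- The mean square `∫_X^{2X} (Δ_k(x+h) - Δ_k(x))² dx`. -/
def shortMeanSquare (k : ℕ) (X h : ℝ) : ℝ :=
  ∫ x in X..(2 * X), (divisorError k (x + h) - divisorError k x) ^ 2

/-- `σ` is an admissible value of `σ(k)`: `1/2 ≤ σ < 1` and, for every `ε > 0`,
`∫_0^T |ζ(σ+it)|^{2k} dt ≪_ε T^{1+ε}`. -/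
def IsAdmissibleSigma (k : ℕ) (σ : ℝ) : Prop :=
  1 / 2 ≤ σ ∧ σ < 1 ∧ ∀ ε : ℝ, 0 < ε →
    (fun T : ℝ => ∫ t in (0 : ℝ)..T,
        ‖riemannZeta ((σ : ℂ) + (t : ℂ) * Complex.I)‖ ^ (2 * k))
      =O[atTop] fun T : ℝ => T ^ (1 + ε)

end

open Filter Asymptotics

/-! ### The generalized divisor function -/

/-! Subtract from `ζ(s)^k / s` its principal part at `s = 1`; what is left, `H`, is holomorphic on
`Re s > 0`. The principal part accounts exactly for the main term, so `E(w) = Δ_k(e^w)` (cut off to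
`w ≥ 0`) has Laplace transform `H` far to the right. Formally, moving the line of integration to `Re
s = σ` turns `e^{-σu}(E(u+b) - E(u))` into a Fourier transform of `H(s)(e^{bs} - 1)`, `s = σ + iy`,
and Plancherel bounds the weighted mean square of `E(u+b) - E(u)` by the mean square of that product
(`lintegral_sq_norm_shift_sub_le`). Convergence is forced by a Gaussian factor `e^{η²s²}`, removed
at the end by Fatou; only the inequality in Plancherel is needed.

On the line, `|H|²|s|² ≪ |ζ|^{2k} + 1` and `|e^{bs} - 1|² ≪ (b|s|)^{1-η}`, so the moment hypothesis
makes the integral `≪ b^{1-η}` (`IsAdmissibleSigma.exists_lintegral_divisorRemainder_shift_le`).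

A shift of `u = log x` by `b` is a multiplicative shift of `x`. Averaging over an auxiliary shift,
in the manner of Saffari and Vaughan, converts these into the additive shift `h`
(`lintegral_additive_shift_le`), giving `X^{2σ+1}(h/X)^{1-η} ≤ X^{2σ+η} h` for `h ≥ 1`. Both
assertions follow by comparing exponents: in (i) `h ≤ h^{4/3}`, and in (ii) one factor `X^θ` is
traded for `h`. -/

theorem divisorFn_zero_right (k : ℕ) : divisorFn k 0 = 0 := by
  simp [divisorFn]

/-- Split off the first coordinate of the tuple; `n = 0` causes no trouble because both sides count
the empty set. -/
theorem divisorFn_succ (k n : ℕ) :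
    divisorFn (k + 1) n = ∑ p ∈ n.divisorsAntidiagonal, divisorFn k p.2 := by
  simp only [divisorFn]
  rw [← Finset.card_sigma]
  refine Finset.card_bij' (fun f _ => ⟨(f 0, ∏ i, Fin.tail f i), Fin.tail f⟩)
    (fun q _ => Fin.cons q.1.1 q.2) ?_ ?_ ?_ ?_
  · intro f hf
    simp only [Nat.mem_finMulAntidiag, Fin.prod_univ_succ] at hf
    obtain ⟨h1, h2⟩ := hf
    simp only [Finset.mem_sigma, Nat.mem_divisorsAntidiagonal, Nat.mem_finMulAntidiag]
    refine ⟨⟨h1, h2⟩, trivial, ?_⟩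
    rintro h0
    rw [← h1] at h2
    exact h2 (by simp only [Fin.tail] at h0; rw [h0, mul_zero])
  · rintro ⟨⟨a, b⟩, f⟩ hq
    simp only [Finset.mem_sigma, Nat.mem_divisorsAntidiagonal, Nat.mem_finMulAntidiag] at hq
    simp only [Nat.mem_finMulAntidiag, Fin.prod_univ_succ, Fin.cons_zero, Fin.cons_succ]
    refine ⟨?_, hq.1.2⟩
    rw [hq.2.1, hq.1.1]
  · intro f _
    exact Fin.cons_self_tail f
  · rintro ⟨⟨a, b⟩, f⟩ hq
    simp only [Finset.mem_sigma, Nat.mem_divisorsAntidiagonal, Nat.mem_finMulAntidiag] at hq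
    simp only [Fin.cons_zero, Fin.tail_cons, hq.2.1]

theorem divisorFn_eq_zeta_pow (k n : ℕ) :
    divisorFn k n = (ArithmeticFunction.zeta ^ k) n := by
  induction k generalizing n with
  | zero =>
    rcases eq_or_ne n 1 with rfl | hn
    · simp [divisorFn, Nat.finMulAntidiag_one]
    · simp [divisorFn, Nat.finMulAntidiag_zero_left hn, hn]
  | succ k ih =>
    rw [divisorFn_succ, pow_succ', ArithmeticFunction.mul_apply]
    refine Finset.sum_congr rfl fun p hp => ?_
    rw [ih, ArithmeticFunction.zeta_apply_ne (Nat.ne_zero_of_mem_divisorsAntidiagonal hp).1,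
      one_mul]

theorem LSeriesSummable_divisorFn_and_LSeries_eq (k : ℕ) {s : ℂ} (hs : 1 < s.re) :
    LSeriesSummable (fun n => (divisorFn k n : ℂ)) s ∧
      LSeries (fun n => (divisorFn k n : ℂ)) s = riemannZeta s ^ k := by
  have key : (fun n => (divisorFn k n : ℂ)) =
      fun n => ((ArithmeticFunction.zeta : ArithmeticFunction ℂ) ^ k) n := by
    ext n
    rw [divisorFn_eq_zeta_pow, ← ArithmeticFunction.natCoe_apply]
    congr 1
    induction k with
    | zero => simp
    | succ k ih => rw [pow_succ, pow_succ, ArithmeticFunction.natCoe_mul, ih]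
  rw [key]
  clear key
  have hz : LSeriesSummable
      (fun n => (ArithmeticFunction.zeta : ArithmeticFunction ℂ) n) s := by
    simpa using ArithmeticFunction.LSeriesSummable_zeta_iff.2 hs
  have hz' : LSeries (fun n => (ArithmeticFunction.zeta : ArithmeticFunction ℂ) n) s =
      riemannZeta s := by
    simpa using ArithmeticFunction.LSeries_zeta_eq_riemannZeta hs
  induction k with
  | zero =>
    have h1 : (fun n => (1 : ArithmeticFunction ℂ) n) = LSeries.delta := by
      ext n
      simp [LSeries.delta, ArithmeticFunction.one_apply]
    simp only [pow_zero, h1]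
    refine ⟨?_, by rw [LSeries_delta]; rfl⟩
    refine summable_of_ne_finset_zero (s := {1}) fun n hn => ?_
    have hn' : n ≠ 1 := by simpa using hn
    simp [LSeries.term_def, LSeries.delta, hn']
  | succ k ih =>
    rw [pow_succ, pow_succ]
    exact ⟨ArithmeticFunction.LSeriesSummable_mul ih.1 hz,
      by rw [ArithmeticFunction.LSeries_mul' ih.1 hz, ih.2, hz']⟩

/-- Deliberately crude: any polynomial bound gives a half-plane where the Laplace transforms
converge absolutely. -/
theorem divisorFn_le_pow (k n : ℕ) : divisorFn k n ≤ n ^ k := by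
  rcases Nat.eq_zero_or_pos n with rfl | hn
  · simp [divisorFn_zero_right]
  induction k generalizing n with
  | zero =>
    rcases eq_or_ne n 1 with rfl | hn'
    · simp [divisorFn, Nat.finMulAntidiag_one]
    · simp [divisorFn, Nat.finMulAntidiag_zero_left hn']
  | succ k ih =>
    rw [divisorFn_succ, Nat.sum_divisorsAntidiagonal' (f := fun _ b => divisorFn k b)]
    calc ∑ i ∈ n.divisors, divisorFn k i ≤ ∑ _i ∈ n.divisors, n ^ k :=
          Finset.sum_le_sum fun i hi =>
            (ih i (Nat.pos_of_mem_divisors hi)).trans (Nat.pow_le_pow_left (Nat.divisor_le hi) k)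
      _ ≤ n ^ (k + 1) := by
          rw [Finset.sum_const, smul_eq_mul, pow_succ']
          exact Nat.mul_le_mul_right _ (Nat.card_divisors_le_self n)

theorem sum_divisorFn_le_pow (k N : ℕ) : ∑ n ∈ Finset.Icc 1 N, divisorFn k n ≤ N ^ (k + 1) := by
  calc ∑ n ∈ Finset.Icc 1 N, divisorFn k n ≤ ∑ _n ∈ Finset.Icc 1 N, N ^ k :=
        Finset.sum_le_sum fun n hn =>
          (divisorFn_le_pow k n).trans (Nat.pow_le_pow_left (Finset.mem_Icc.1 hn).2 k)
    _ = N ^ (k + 1) := by simp [pow_succ']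

/-! ### Growth of the zeta function in vertical strips -/

/-- Inside the strip `x^{Re s - 1}` is at most `x^{a-1}` for `x ≤ 1` and at most `x^{b-1}` for `x ≥
1`, so the sum of the two edge integrands dominates. -/
theorem norm_mellin_le_of_mem_strip {E : Type*} [NormedAddCommGroup E] [NormedSpace ℂ E]
    {f : ℝ → E} {a b : ℝ} (ha : MellinConvergent f a) (hb : MellinConvergent f b) :
    ∃ C : ℝ, ∀ s : ℂ, a ≤ s.re → s.re ≤ b → ‖mellin f s‖ ≤ C := by
  have key : ∀ (x : ℝ), x ∈ Set.Ioi (0 : ℝ) → ∀ s : ℂ,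
      ‖(x : ℂ) ^ (s - 1) • f x‖ = x ^ (s.re - 1) * ‖f x‖ := by
    intro x hx s
    rw [norm_smul, Complex.norm_cpow_eq_rpow_re_of_pos hx, Complex.sub_re, Complex.one_re]
  refine ⟨∫ x in Set.Ioi (0 : ℝ),
    (‖(x : ℂ) ^ ((a : ℂ) - 1) • f x‖ + ‖(x : ℂ) ^ ((b : ℂ) - 1) • f x‖), fun s h1 h2 => ?_⟩
  refine MeasureTheory.norm_integral_le_of_norm_le (ha.norm.add hb.norm) ?_
  filter_upwards [MeasureTheory.ae_restrict_mem measurableSet_Ioi] with x hx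
  rw [key x hx, key x hx, key x hx, ← add_mul]
  refine mul_le_mul_of_nonneg_right ?_ (norm_nonneg _)
  simp only [Complex.ofReal_re]
  have hx' : (0 : ℝ) < x := hx
  rcases le_total x 1 with h | h
  · have := Real.rpow_le_rpow_of_exponent_ge hx' h (sub_le_sub_right h1 1)
    have := Real.rpow_nonneg hx'.le (b - 1)
    linarith
  · have := Real.rpow_le_rpow_of_exponent_le h (sub_le_sub_right h2 1)
    have := Real.rpow_nonneg hx'.le (a - 1)
    linarith

theorem norm_completedRiemannZeta₀_le_of_mem_strip (a b : ℝ) :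
    ∃ C : ℝ, ∀ s : ℂ, a ≤ s.re → s.re ≤ b → ‖completedRiemannZeta₀ s‖ ≤ C := by
  set P := HurwitzZeta.hurwitzEvenFEPair 0
  have hP := P.isStrongFEPair_toStrongFEPair
  obtain ⟨C, hC⟩ := norm_mellin_le_of_mem_strip (hP.hasMellin ((a / 2 : ℝ) : ℂ)).1
    (hP.hasMellin ((b / 2 : ℝ) : ℂ)).1
  refine ⟨C / 2, fun s h1 h2 => ?_⟩
  have := hC (s / 2) (by simpa using by linarith) (by simpa using by linarith)
  change ‖P.Λ₀ (s / 2) / 2‖ ≤ _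
  rw [norm_div, Complex.norm_ofNat]
  exact div_le_div_of_nonneg_right this zero_le_two

theorem norm_Gamma_le_of_mem_strip {a : ℝ} (ha : 0 < a) (b : ℝ) :
    ∃ C : ℝ, ∀ s : ℂ, a ≤ s.re → s.re ≤ b → ‖Complex.Gamma s‖ ≤ C := by
  have hconv : ∀ x : ℝ, 0 < x → MellinConvergent (fun x : ℝ => (Real.exp (-x) : ℂ)) (x : ℂ) := by
    intro x hx
    refine (Complex.GammaIntegral_convergent (s := x) (by simpa using hx)).congr_fun
      (fun y _ => ?_) measurableSet_Ioi
    simp [mul_comm]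
  rcases lt_or_ge b a with h | h
  · exact ⟨0, fun s h1 h2 => absurd (h1.trans h2) (not_le.2 h)⟩
  obtain ⟨C, hC⟩ := norm_mellin_le_of_mem_strip (hconv a ha) (hconv b (ha.trans_le h))
  refine ⟨C, fun s h1 h2 => ?_⟩
  rw [Complex.Gamma_eq_integral (ha.trans_le h1), Complex.GammaIntegral_eq_mellin]
  exact hC s h1 h2

theorem norm_sin_le_exp_abs_im (z : ℂ) : ‖Complex.sin z‖ ≤ Real.exp |z.im| := by
  have h : ∀ w : ℂ, |w.re| = |z.im| → ‖Complex.exp w‖ ≤ Real.exp |z.im| := by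
    intro w hw
    rw [Complex.norm_exp, ← hw]
    exact Real.exp_le_exp.2 (le_abs_self _)
  rw [Complex.sin, norm_div, norm_mul, Complex.norm_I, mul_one, Complex.norm_ofNat,
    div_le_iff₀ two_pos, mul_two]
  refine (norm_sub_le _ _).trans (add_le_add (h _ ?_) (h _ ?_)) <;> simp

/-- Exponential growth in `|Im s|` is good enough, since a Gaussian factor will absorb it when the
contour is moved. The completed zeta function is bounded in the strip up to its polar terms, so only
`1/Γ(s/2)` has to be estimated. -/
theorem norm_riemannZeta_le_of_re_mem_Icc :
    ∃ C : ℝ, ∀ s : ℂ, 1 / 2 ≤ s.re → s.re ≤ 3 / 2 → 1 ≤ |s.im| →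
      ‖riemannZeta s‖ ≤ C * Real.exp (2 * |s.im|) := by
  obtain ⟨A, hA⟩ := norm_completedRiemannZeta₀_le_of_mem_strip (1 / 2) (3 / 2)
  obtain ⟨B, hB⟩ := norm_Gamma_le_of_mem_strip (a := 1 / 4) (by norm_num) (3 / 4)
  refine ⟨(A + 2) * (Real.pi * (B / Real.pi)), fun s h1 h2 h3 => ?_⟩
  have hs0 : s ≠ 0 := by
    rintro rfl
    simp at h3
    linarith
  have him : 1 ≤ ‖s‖ := h3.trans (Complex.abs_im_le_norm s)
  have him' : 1 ≤ ‖1 - s‖ := h3.trans (by simpa using Complex.abs_im_le_norm (1 - s))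
  have hnum : ‖completedRiemannZeta₀ s - 1 / s - 1 / (1 - s)‖ ≤ A + 2 := by
    have e1 : ‖1 / s‖ ≤ 1 := by
      rw [norm_div, norm_one]; exact div_le_one_of_le₀ him (norm_nonneg _)
    have e2 : ‖1 / (1 - s)‖ ≤ 1 := by
      rw [norm_div, norm_one]; exact div_le_one_of_le₀ him' (norm_nonneg _)
    have := hA s h1 h2
    have := norm_sub_le (completedRiemannZeta₀ s - 1 / s) (1 / (1 - s))
    have := norm_sub_le (completedRiemannZeta₀ s) (1 / s)
    linarith
  have hsin : Complex.sin (Real.pi * (s / 2)) ≠ 0 := by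
    intro h0
    rw [Complex.sin_eq_zero_iff] at h0
    obtain ⟨n, hn⟩ := h0
    have := congrArg Complex.im hn
    simp at this
    rw [this] at h3
    simp at h3
    linarith
  have hG : Complex.Gamma (s / 2) ≠ 0 :=
    Complex.Gamma_ne_zero_of_re_pos (by simp; linarith)
  have hrefl := Complex.Gamma_mul_Gamma_one_sub (s / 2)
  -- The reflection formula replaces a lower bound for `Γ(s/2)` by upper bounds for `Γ(1 - s/2)` and
  -- the sine.
  have hinv : (Complex.Gammaℝ s)⁻¹ = (Real.pi : ℂ) ^ (s / 2) *
      (Complex.Gamma (1 - s / 2) * Complex.sin (Real.pi * (s / 2)) / Real.pi) := by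
    rw [Complex.Gammaℝ_def, mul_inv, neg_div, Complex.cpow_neg, inv_inv]
    congr 1
    have hpi : (Real.pi : ℂ) ≠ 0 := by exact_mod_cast Real.pi_ne_zero
    rw [eq_div_iff hsin] at hrefl
    rw [inv_eq_one_div, div_eq_div_iff hG hpi, one_mul]
    linear_combination -hrefl
  rw [riemannZeta_eq_completedRiemannZeta₀ hs0, ← Complex.Gammaℝ_def, div_eq_mul_inv, norm_mul, hinv, mul_assoc]
  refine mul_le_mul hnum ?_ (norm_nonneg _) ((norm_nonneg _).trans hnum)
  rw [norm_mul, mul_assoc]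
  have hpi0 := Real.pi_pos
  refine mul_le_mul ?_ ?_ (norm_nonneg _) hpi0.le
  · rw [Complex.norm_cpow_eq_rpow_re_of_pos hpi0]
    calc Real.pi ^ (s / 2).re ≤ Real.pi ^ (1 : ℝ) :=
          Real.rpow_le_rpow_of_exponent_le (by linarith [Real.pi_gt_three])
            (by simp; linarith)
      _ = Real.pi := Real.rpow_one _
  · have hΓ := hB (1 - s / 2) (by simp; linarith) (by simp; linarith)
    rw [norm_div, norm_mul, Complex.norm_real, Real.norm_of_nonneg hpi0.le, div_mul_eq_mul_div]
    refine div_le_div_of_nonneg_right ?_ hpi0.le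
    refine mul_le_mul hΓ ((norm_sin_le_exp_abs_im _).trans (Real.exp_le_exp.2 ?_))
      (norm_nonneg _) ((norm_nonneg _).trans hΓ)
    have : (Real.pi * (s / 2) : ℂ).im = Real.pi * (s.im / 2) := by simp
    rw [this, abs_mul, abs_div, abs_of_pos hpi0, abs_two]
    nlinarith [Real.pi_lt_four, abs_nonneg s.im]

/-- The contour will start at `Re s = k + 3`, so the bound must reach that far; to the right of
`3/2` the Dirichlet series is bounded. -/
theorem norm_riemannZeta_le_of_one_half_le_re :
    ∃ C : ℝ, ∀ s : ℂ, 1 / 2 ≤ s.re → 1 ≤ |s.im| →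
      ‖riemannZeta s‖ ≤ C * Real.exp (2 * |s.im|) := by
  obtain ⟨C, hC⟩ := norm_riemannZeta_le_of_re_mem_Icc
  set Z : ℝ := ∑' n : ℕ, 1 / (n : ℝ) ^ (3 / 2 : ℝ)
  have hsum : Summable fun n : ℕ => 1 / (n : ℝ) ^ (3 / 2 : ℝ) :=
    Real.summable_one_div_nat_rpow.2 (by norm_num)
  refine ⟨max C Z, fun s h1 h2 => ?_⟩
  rcases le_total s.re (3 / 2) with h | h
  · exact (hC s h1 h h2).trans (mul_le_mul_of_nonneg_right (le_max_left _ _) (Real.exp_pos _).le)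
  have hZ : ‖riemannZeta s‖ ≤ Z := by
    rw [zeta_eq_tsum_one_div_nat_cpow (by linarith)]
    refine tsum_of_norm_bounded hsum.hasSum fun n => ?_
    rcases Nat.eq_zero_or_pos n with rfl | hn
    · rw [Nat.cast_zero, Complex.zero_cpow (by rintro rfl; simp at h; linarith)]
      simp
    · rw [norm_div, norm_one, Complex.norm_natCast_cpow_of_pos hn]
      refine one_div_le_one_div_of_le (by positivity)
        (Real.rpow_le_rpow_of_exponent_le (by exact_mod_cast hn) h)
  have hZ0 : 0 ≤ Z := (norm_nonneg _).trans hZ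
  calc ‖riemannZeta s‖ ≤ Z * 1 := by simpa using hZ
    _ ≤ max C Z * Real.exp (2 * |s.im|) :=
      mul_le_mul (le_max_right _ _) (Real.one_le_exp (by positivity)) zero_le_one
        (hZ0.trans (le_max_right _ _))

/-! ### Laurent expansion at the pole and the main term -/

/-- Iterating `dslope` keeps the remainder differentiable on all of `U`, not only on a disc about
`c`. -/
theorem exists_taylor_expansion_of_differentiableOn {g : ℂ → ℂ} {U : Set ℂ} {c : ℂ}
    (hU : U ∈ nhds c) (hg : DifferentiableOn ℂ g U) (n : ℕ) :
    ∃ (a : ℕ → ℂ) (r : ℂ → ℂ), DifferentiableOn ℂ r U ∧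
      ∀ z, g z = ∑ j ∈ Finset.range n, a j * (z - c) ^ j + (z - c) ^ n * r z := by
  induction n with
  | zero => exact ⟨0, g, hg, fun z => by simp⟩
  | succ n ih =>
    obtain ⟨a, r, hr, h⟩ := ih
    refine ⟨fun j => if j = n then r c else a j, dslope r c,
      (Complex.differentiableOn_dslope hU).2 hr, fun z => ?_⟩
    have h1 : (z - c) * dslope r c z = r z - r c := sub_smul_dslope r c z
    have h2 : ∑ j ∈ Finset.range n, (if j = n then r c else a j) * (z - c) ^ j =
        ∑ j ∈ Finset.range n, a j * (z - c) ^ j :=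
      Finset.sum_congr rfl fun j hj => by rw [if_neg (Finset.mem_range.1 hj).ne]
    simp only [Finset.sum_range_succ, if_true]
    rw [h z, pow_succ, mul_assoc, h1, h2]
    ring

theorem isOpen_re_pos : IsOpen {s : ℂ | 0 < s.re} :=
  isOpen_lt continuous_const Complex.continuous_re

theorem exists_laurent_expansion_zeta_pow_div (k : ℕ) :
    ∃ (a : ℕ → ℂ) (H : ℂ → ℂ), DifferentiableOn ℂ H {s | 0 < s.re} ∧
      ∀ s : ℂ, 0 < s.re → s ≠ 1 → riemannZeta s ^ k / s =
        ∑ j ∈ Finset.range k, a j / (s - 1) ^ (j + 1) + H s := by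
  have hg : DifferentiableOn ℂ (fun s => riemannZeta₁ s ^ k / s) {s : ℂ | 0 < s.re} := by
    refine (differentiable_riemannZeta₁.pow k).differentiableOn.div differentiableOn_id ?_
    rintro s hs rfl
    simp at hs
  have hU : {s : ℂ | 0 < s.re} ∈ nhds (1 : ℂ) := isOpen_re_pos.mem_nhds (by simp)
  obtain ⟨b, H, hH, h⟩ := exists_taylor_expansion_of_differentiableOn hU hg k
  -- After division by `(s-1)^k` the Taylor term of degree `i` becomes a pole of order `k - i = j +
  -- 1`, whence the reversed index.
  refine ⟨fun j => b (k - 1 - j), H, hH, fun s _ hs1 => ?_⟩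
  have hs1' : s - 1 ≠ 0 := sub_ne_zero.2 hs1
  have h2 : riemannZeta s ^ k / s = (riemannZeta₁ s ^ k / s) / (s - 1) ^ k := by
    rw [riemannZeta_eq_inv_sub_mul hs1, mul_pow, inv_pow]
    ring
  rw [h2, h s, add_div, mul_div_cancel_left₀ _ (pow_ne_zero _ hs1'), Finset.sum_div]
  congr 1
  rw [← Finset.sum_range_reflect]
  refine Finset.sum_congr rfl fun j hj => ?_
  have hj' := Finset.mem_range.1 hj
  rw [div_eq_div_iff (pow_ne_zero _ hs1') (pow_ne_zero _ hs1'), mul_assoc, ← pow_add]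
  congr 2
  omega

/-- A pole of order `j + 1` extracts the `j`-th Taylor coefficient `e^w w^j / j!` of `e^{ws}` at
`1`, and `H` contributes nothing by Cauchy. -/
theorem divisorMainTerm_eq_of_laurent {k : ℕ} {a : ℕ → ℂ} {H : ℂ → ℂ}
    (hH : DifferentiableOn ℂ H {s | 0 < s.re})
    (h : ∀ s : ℂ, 0 < s.re → s ≠ 1 → riemannZeta s ^ k / s =
        ∑ j ∈ Finset.range k, a j / (s - 1) ^ (j + 1) + H s) (w : ℝ) :
    divisorMainTerm k (Real.exp w) =
      (Complex.exp w * ∑ j ∈ Finset.range k, a j * (w : ℂ) ^ j / j.factorial).re := by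
  have hval : ∀ᶠ r : ℝ in nhdsWithin (0 : ℝ) (Set.Ioi 0),
      (2 * (Real.pi : ℂ) * Complex.I)⁻¹ *
        circleIntegral (fun s : ℂ => ((Real.exp w : ℝ) : ℂ) ^ s * riemannZeta s ^ k / s) 1 r =
      Complex.exp w * ∑ j ∈ Finset.range k, a j * (w : ℂ) ^ j / j.factorial := by
    -- Radii below `1` keep the closed disc inside `Re s > 0`; the circle integral is then
    -- independent of `r`, so the limit defining `residue` is that of a constant.
    filter_upwards [Ioo_mem_nhdsGT (zero_lt_one' ℝ)] with r hr
    have hpos : ∀ s ∈ Metric.closedBall (1 : ℂ) r, 0 < s.re := by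
      intro s hs
      have h1 := (Complex.abs_re_le_norm (s - 1)).trans (mem_closedBall_iff_norm.1 hs)
      have h2 := abs_le.1 h1
      simp only [Complex.sub_re, Complex.one_re] at h2
      linarith [hr.2, h2.1]
    have hexpd : Differentiable ℂ fun s : ℂ => Complex.exp ((w : ℂ) * s) := by fun_prop
    have hcong : Set.EqOn
        (fun s : ℂ => ((Real.exp w : ℝ) : ℂ) ^ s * riemannZeta s ^ k / s)
        (fun s : ℂ => ∑ j ∈ Finset.range k,
          a j * ((1 / (s - 1) ^ (j + 1)) • Complex.exp ((w : ℂ) * s)) +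
            H s * Complex.exp ((w : ℂ) * s)) (Metric.sphere 1 r) := by
      intro s hs
      have hs1 : s ≠ 1 := by
        rintro rfl
        have := hr.1
        simp at hs
        linarith
      have hexp : ((Real.exp w : ℝ) : ℂ) ^ s = Complex.exp ((w : ℂ) * s) := by
        rw [Complex.cpow_def_of_ne_zero (by exact_mod_cast (Real.exp_pos w).ne'),
          ← Complex.ofReal_log (Real.exp_pos w).le, Real.log_exp]
      simp only []
      rw [mul_div_assoc, h s (hpos s (Metric.sphere_subset_closedBall hs)) hs1, hexp, mul_add,
        Finset.mul_sum, mul_comm _ (H s)]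
      congr 1
      refine Finset.sum_congr rfl fun j _ => ?_
      rw [smul_eq_mul]
      ring
    rw [circleIntegral.integral_congr hr.1.le hcong]
    have hHint : DifferentiableOn ℂ (fun s => H s * Complex.exp ((w : ℂ) * s))
        (Metric.closedBall 1 r) :=
      (hH.mono fun s hs => hpos s hs).mul hexpd.differentiableOn
    have hci : ∀ j : ℕ, CircleIntegrable
        (fun s : ℂ => a j * ((1 / (s - 1) ^ (j + 1)) • Complex.exp ((w : ℂ) * s))) 1 r := by
      intro j
      have hc : ContinuousOn (fun s : ℂ => (s - 1) ^ (j + 1)) (Metric.sphere 1 r) := by fun_prop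
      refine ContinuousOn.circleIntegrable hr.1.le (continuousOn_const.mul
        (ContinuousOn.smul (continuousOn_const.div hc ?_) hexpd.continuous.continuousOn))
      intro s hs
      refine pow_ne_zero _ (sub_ne_zero.2 ?_)
      rintro rfl
      have := hr.1
      simp at hs
      linarith
    rw [circleIntegral.integral_add, circleIntegral.integral_fun_sum]
    rotate_left
    · exact fun j _ => hci j
    · exact CircleIntegrable.fun_sum _ fun j _ => hci j
    · exact (hHint.continuousOn.mono Metric.sphere_subset_closedBall).circleIntegrable hr.1.le
    have h0 : circleIntegral (fun s => H s * Complex.exp ((w : ℂ) * s)) 1 r = 0 :=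
      Complex.circleIntegral_eq_zero_of_differentiable_on_off_countable hr.1.le
        Set.countable_empty hHint.continuousOn fun z hz =>
          hHint.differentiableAt (Metric.closedBall_mem_nhds_of_mem hz.1)
    rw [h0, add_zero, Finset.mul_sum, Finset.mul_sum]
    refine Finset.sum_congr rfl fun j _ => ?_
    rw [circleIntegral.integral_const_mul,
      DifferentiableOn.circleIntegral_one_div_sub_center_pow_smul hr.1 j hexpd.differentiableOn,
      iteratedDeriv_cexp_const_mul, smul_eq_mul]
    have hpi : (Real.pi : ℂ) ≠ 0 := by exact_mod_cast Real.pi_ne_zero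
    have hI := Complex.I_ne_zero
    have hf : (j.factorial : ℂ) ≠ 0 := by exact_mod_cast j.factorial_ne_zero
    simp only [mul_one]
    field_simp
  have hlim := (tendsto_const_nhds.congr' (EventuallyEq.symm hval)).limUnder_eq
  rw [divisorMainTerm, residue, hlim]

/-! ### Laplace transforms -/

theorem integrableOn_pow_mul_cexp_neg_mul (j : ℕ) {z : ℂ} (hz : 0 < z.re) :
    MeasureTheory.IntegrableOn (fun w : ℝ => (w : ℂ) ^ j * Complex.exp (-z * w)) (Set.Ioi 0) := by
  have h := integrableOn_rpow_mul_exp_neg_mul_rpow (p := 1) (s := (j : ℝ)) (b := z.re)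
    (by have : (0 : ℝ) ≤ j := by positivity
        linarith) one_pos hz
  refine MeasureTheory.Integrable.mono' h (Continuous.aestronglyMeasurable (by fun_prop)) ?_
  filter_upwards [MeasureTheory.ae_restrict_mem measurableSet_Ioi] with w hw
  have hw' : (0 : ℝ) < w := hw
  rw [norm_mul, norm_pow, Complex.norm_real, Real.norm_of_nonneg hw'.le, Complex.norm_exp]
  simp

theorem tendsto_pow_mul_cexp_neg_mul_atTop (j : ℕ) {z : ℂ} (hz : 0 < z.re) :
    Tendsto (fun w : ℝ => (w : ℂ) ^ j * Complex.exp (-z * w)) atTop (nhds 0) := by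
  rw [tendsto_zero_iff_norm_tendsto_zero]
  refine (tendsto_rpow_mul_exp_neg_mul_atTop_nhds_zero j z.re hz).congr' ?_
  filter_upwards [eventually_ge_atTop 0] with w hw
  rw [norm_mul, norm_pow, Complex.norm_real, Real.norm_of_nonneg hw, Complex.norm_exp]
  simp

theorem integral_pow_mul_cexp_neg_mul (j : ℕ) {z : ℂ} (hz : 0 < z.re) :
    ∫ w in Set.Ioi (0 : ℝ), (w : ℂ) ^ j * Complex.exp (-z * w) = j.factorial / z ^ (j + 1) := by
  have hz0 : z ≠ 0 := by rintro rfl; simp at hz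
  induction j with
  | zero =>
    simp only [pow_zero, one_mul]
    rw [integral_exp_mul_complex_Ioi (by simpa using hz)]
    simp
  | succ j ih =>
    have hd : ∀ w ∈ Set.Ici (0 : ℝ), HasDerivAt
        (fun w : ℝ => (w : ℂ) ^ (j + 1) * Complex.exp (-z * w))
        ((j + 1 : ℂ) * ((w : ℂ) ^ j * Complex.exp (-z * w)) -
          z * ((w : ℂ) ^ (j + 1) * Complex.exp (-z * w))) w := by
      intro w _
      have h1 : HasDerivAt (fun w : ℝ => (w : ℂ)) 1 w := Complex.ofRealCLM.hasDerivAt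
      have h2 := (h1.pow (j + 1)).mul ((h1.const_mul (-z)).cexp)
      refine h2.congr_deriv ?_
      simp only [Nat.add_sub_cancel, Nat.cast_add, Nat.cast_one, Pi.pow_apply]
      ring
    have hi1 := (integrableOn_pow_mul_cexp_neg_mul j hz).const_mul (j + 1 : ℂ)
    have hi2 := (integrableOn_pow_mul_cexp_neg_mul (j + 1) hz).const_mul z
    have := MeasureTheory.integral_Ioi_of_hasDerivAt_of_tendsto' hd (hi1.sub hi2)
      (tendsto_pow_mul_cexp_neg_mul_atTop (j + 1) hz)
    rw [MeasureTheory.integral_sub hi1 hi2, MeasureTheory.integral_const_mul,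
      MeasureTheory.integral_const_mul, ih] at this
    simp only [Complex.ofReal_zero, zero_pow (Nat.succ_ne_zero j), zero_mul, sub_zero] at this
    have h3 := sub_eq_zero.1 this
    rw [eq_div_iff (pow_ne_zero _ hz0), Nat.factorial_succ]
    rw [pow_succ', ← mul_assoc, mul_comm _ z, ← h3, mul_assoc,
      div_mul_cancel₀ _ (pow_ne_zero _ hz0)]
    push_cast
    ring

/-- The difference between `∑_{n ≤ e^w} d_k(n)` and `e^w ∑_{j < k} a_j w^j / j!`, cut off to
`w ≥ 0`. -/
noncomputable def divisorRemainder (k : ℕ) (a : ℕ → ℂ) (w : ℝ) : ℂ :=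
  if w < 0 then 0 else
    ∑ n ∈ Finset.Icc 1 ⌊Real.exp w⌋₊, (divisorFn k n : ℂ) -
      Complex.exp w * ∑ j ∈ Finset.range k, a j * (w : ℂ) ^ j / j.factorial

theorem measurable_divisorRemainder (k : ℕ) (a : ℕ → ℂ) : Measurable (divisorRemainder k a) := by
  refine Measurable.ite measurableSet_Iio measurable_const (Measurable.sub ?_ ?_)
  · exact (Measurable.of_discrete (f := fun N : ℕ =>
      ∑ n ∈ Finset.Icc 1 N, (divisorFn k n : ℂ))).comp
        (Nat.measurable_floor.comp Real.measurable_exp)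
  · exact Continuous.measurable (by fun_prop)

theorem divisorError_exp_eq {k : ℕ} {a : ℕ → ℂ} {H : ℂ → ℂ}
    (hH : DifferentiableOn ℂ H {s | 0 < s.re})
    (h : ∀ s : ℂ, 0 < s.re → s ≠ 1 → riemannZeta s ^ k / s =
        ∑ j ∈ Finset.range k, a j / (s - 1) ^ (j + 1) + H s) {w : ℝ} (hw : 0 ≤ w) :
    divisorError k (Real.exp w) = (divisorRemainder k a w).re := by
  rw [divisorError, divisorMainTerm_eq_of_laurent hH h, divisorRemainder, if_neg (not_lt.2 hw),
    Complex.sub_re, Complex.re_sum]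
  simp

theorem sum_divisorFn_exp_le {k : ℕ} {w : ℝ} (hw : 0 ≤ w) :
    ‖∑ n ∈ Finset.Icc 1 ⌊Real.exp w⌋₊, (divisorFn k n : ℂ)‖ ≤ Real.exp ((k + 2) * w) := by
  have h1 : ‖∑ n ∈ Finset.Icc 1 ⌊Real.exp w⌋₊, (divisorFn k n : ℂ)‖ ≤
      (⌊Real.exp w⌋₊ : ℝ) ^ (k + 1) := by
    rw [← Nat.cast_sum, Complex.norm_natCast]
    exact_mod_cast sum_divisorFn_le_pow k _
  refine h1.trans ?_
  calc (⌊Real.exp w⌋₊ : ℝ) ^ (k + 1) ≤ Real.exp w ^ (k + 1) :=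
        pow_le_pow_left₀ (by positivity) (Nat.floor_le (Real.exp_pos w).le) _
    _ = Real.exp ((k + 1) * w) := by rw [← Real.exp_nat_mul]; simp
    _ ≤ _ := Real.exp_le_exp.2 (by nlinarith)

theorem exists_norm_divisorRemainder_le (k : ℕ) (a : ℕ → ℂ) :
    ∃ C : ℝ, ∀ w, ‖divisorRemainder k a w‖ ≤ C * Real.exp ((k + 2) * w) := by
  refine ⟨1 + ∑ j ∈ Finset.range k, ‖a j‖, fun w => ?_⟩
  have hA : 0 ≤ ∑ j ∈ Finset.range k, ‖a j‖ := Finset.sum_nonneg fun _ _ => norm_nonneg _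
  rw [divisorRemainder]
  split_ifs with hw
  · rw [norm_zero]; positivity
  push Not at hw
  rw [add_mul, one_mul]
  refine (norm_sub_le _ _).trans (add_le_add (sum_divisorFn_exp_le hw) ?_)
  have h2 : ‖∑ j ∈ Finset.range k, a j * (w : ℂ) ^ j / j.factorial‖ ≤
      (∑ j ∈ Finset.range k, ‖a j‖) * Real.exp w := by
    rw [Finset.sum_mul]
    refine (norm_sum_le _ _).trans (Finset.sum_le_sum fun j _ => ?_)
    rw [mul_div_assoc, norm_mul, norm_div, norm_pow, Complex.norm_real, Complex.norm_natCast,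
      Real.norm_of_nonneg hw]
    exact mul_le_mul_of_nonneg_left (Real.pow_div_factorial_le_exp w hw j) (norm_nonneg _)
  rw [norm_mul, Complex.norm_exp, Complex.ofReal_re]
  calc Real.exp w * _ ≤ Real.exp w * ((∑ j ∈ Finset.range k, ‖a j‖) * Real.exp w) :=
        mul_le_mul_of_nonneg_left h2 (Real.exp_pos w).le
    _ = (∑ j ∈ Finset.range k, ‖a j‖) * Real.exp (2 * w) := by rw [two_mul, Real.exp_add]; ring
    _ ≤ _ := mul_le_mul_of_nonneg_left (Real.exp_le_exp.2 (by
        have : (0 : ℝ) ≤ k := by positivity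
        nlinarith)) hA

/-- Jumps occur only at `w = log n`; the one caused by the cutoff at `w = 0` is the case `n = 1`. -/
theorem ae_continuousAt_divisorRemainder (k : ℕ) (a : ℕ → ℂ) :
    ∀ᵐ w : ℝ, ContinuousAt (divisorRemainder k a) w := by
  have hc : (Set.range fun n : ℕ => Real.log n).Countable := Set.countable_range _
  filter_upwards [hc.ae_notMem MeasureTheory.volume] with w hw
  rcases lt_trichotomy w 0 with h | h | h
  · refine (continuousAt_const (y := (0 : ℂ))).congr ?_
    filter_upwards [Iio_mem_nhds h] with v hv
    rw [divisorRemainder, if_pos (Set.mem_Iio.1 hv)]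
  · exact absurd ⟨1, by simp [h]⟩ hw
  · set N := ⌊Real.exp w⌋₊
    have h1 : (N : ℝ) < Real.exp w := by
      refine lt_of_le_of_ne (Nat.floor_le (Real.exp_pos w).le) fun h => hw ⟨N, ?_⟩
      simp only [h, Real.log_exp]
    have h2 : Real.exp w < N + 1 := Nat.lt_floor_add_one _
    have hev : ∀ᶠ v in nhds w, ⌊Real.exp v⌋₊ = N := by
      have := Real.continuous_exp.continuousAt (x := w) |>.eventually (Ioo_mem_nhds h1 h2)
      filter_upwards [this] with v hv
      exact (Nat.floor_eq_iff (Real.exp_pos v).le).2 ⟨hv.1.le, hv.2⟩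
    have hcont : Continuous fun v : ℝ => ∑ n ∈ Finset.Icc 1 N, (divisorFn k n : ℂ) -
        Complex.exp v * ∑ j ∈ Finset.range k, a j * (v : ℂ) ^ j / j.factorial := by fun_prop
    refine hcont.continuousAt.congr ?_
    filter_upwards [hev, Ioi_mem_nhds h] with v hv hv'
    rw [divisorRemainder, if_neg (not_lt.2 (le_of_lt hv')), hv]

theorem integrableOn_Ioi_of_norm_le_exp {f : ℝ → ℂ} (hf : Measurable f) {C b : ℝ}
    (hb : ∀ w : ℝ, 0 < w → ‖f w‖ ≤ C * Real.exp (b * w)) {s : ℂ} (hs : b < s.re) :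
    MeasureTheory.IntegrableOn (fun w : ℝ => f w * Complex.exp (-s * w)) (Set.Ioi 0) := by
  have h0 : MeasureTheory.IntegrableOn (fun w : ℝ => C * Real.exp ((b - s.re) * w))
      (Set.Ioi 0) := (integrableOn_exp_mul_Ioi (by linarith) 0).const_mul C
  refine MeasureTheory.Integrable.mono' h0 ?_ ?_
  · exact (hf.mul (Continuous.measurable (by fun_prop))).aestronglyMeasurable
  filter_upwards [MeasureTheory.ae_restrict_mem measurableSet_Ioi] with w hw
  rw [norm_mul, Complex.norm_exp]
  have : (-s * (w : ℂ)).re = -s.re * w := by simp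
  rw [this]
  calc ‖f w‖ * Real.exp (-s.re * w) ≤ C * Real.exp (b * w) * Real.exp (-s.re * w) :=
        mul_le_mul_of_nonneg_right (hb w hw) (Real.exp_pos _).le
    _ = C * Real.exp ((b - s.re) * w) := by rw [mul_assoc, ← Real.exp_add]; ring_nf

/-- Partial summation of the Dirichlet series, followed by the substitution `t = e^w`. -/
theorem integral_sum_divisorFn_mul_cexp (k : ℕ) {s : ℂ} (hs : k + 2 < s.re) :
    ∫ w in Set.Ioi (0 : ℝ), (∑ n ∈ Finset.Icc 1 ⌊Real.exp w⌋₊, (divisorFn k n : ℂ)) *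
      Complex.exp (-s * w) = riemannZeta s ^ k / s := by
  have hk0 : (0 : ℝ) ≤ k := by positivity
  obtain ⟨hsum, hL⟩ := LSeriesSummable_divisorFn_and_LSeries_eq k (s := s) (by linarith)
  have hs0 : s ≠ 0 := by rintro rfl; simp at hs; linarith
  have hO : (fun n : ℕ => ∑ m ∈ Finset.Icc 1 n, (divisorFn k m : ℂ)) =O[atTop]
      fun n => (n : ℝ) ^ ((k + 1 : ℕ) : ℝ) := by
    refine IsBigO.of_bound 1 (Eventually.of_forall fun n => ?_)
    rw [one_mul, Real.rpow_natCast, ← Nat.cast_sum, Complex.norm_natCast,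
      Real.norm_of_nonneg (by positivity)]
    exact_mod_cast sum_divisorFn_le_pow k n
  have hI := LSeries_eq_mul_integral _ (r := ((k + 1 : ℕ) : ℝ)) (by positivity)
    (by push_cast; linarith) hsum hO
  rw [hL] at hI
  rw [hI, mul_div_cancel_left₀ _ hs0]
  have himg : Real.exp '' Set.Ioi 0 = Set.Ioi 1 := by
    ext y
    constructor
    · rintro ⟨w, hw, rfl⟩
      exact Real.one_lt_exp_iff.2 hw
    · intro hy
      exact ⟨Real.log y, Real.log_pos hy, Real.exp_log (zero_lt_one.trans hy)⟩
  rw [← himg, MeasureTheory.integral_image_eq_integral_abs_deriv_smul measurableSet_Ioi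
    (fun x _ => (Real.hasDerivAt_exp x).hasDerivWithinAt) Real.exp_injective.injOn]
  refine MeasureTheory.setIntegral_congr_fun measurableSet_Ioi fun w _ => ?_
  rw [abs_of_pos (Real.exp_pos w), Complex.cpow_def_of_ne_zero
    (by exact_mod_cast (Real.exp_pos w).ne'), ← Complex.ofReal_log (Real.exp_pos w).le,
    Real.log_exp, Complex.real_smul, mul_left_comm, Complex.ofReal_exp, ← Complex.exp_add]
  congr 2
  ring

/-- The function `e^w w^j / j!` on `w > 0` has Laplace transform `(s-1)^{-(j+1)}`, so subtracting
the main term removes precisely the principal part. -/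
theorem integral_divisorRemainder_mul_cexp {k : ℕ} {a : ℕ → ℂ} {H : ℂ → ℂ}
    (h : ∀ s : ℂ, 0 < s.re → s ≠ 1 → riemannZeta s ^ k / s =
        ∑ j ∈ Finset.range k, a j / (s - 1) ^ (j + 1) + H s) {s : ℂ} (hs : k + 2 < s.re) :
    ∫ w : ℝ, divisorRemainder k a w * Complex.exp (-s * w) = H s := by
  have hk0 : (0 : ℝ) ≤ k := by positivity
  have hs1 : s ≠ 1 := by rintro rfl; simp at hs; linarith
  have hre : 0 < (s - 1).re := by simp; linarith
  have h0 : ∀ w ∉ Set.Ici (0 : ℝ), divisorRemainder k a w * Complex.exp (-s * w) = 0 := by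
    intro w hw
    rw [divisorRemainder, if_pos (not_le.1 hw), zero_mul]
  rw [← MeasureTheory.setIntegral_eq_integral_of_forall_compl_eq_zero h0,
    MeasureTheory.integral_Ici_eq_integral_Ioi]
  have hmi : ∀ j ∈ Finset.range k, MeasureTheory.IntegrableOn (fun w : ℝ => a j / j.factorial *
      ((w : ℂ) ^ j * Complex.exp (-(s - 1) * w))) (Set.Ioi 0) := fun j _ =>
    (integrableOn_pow_mul_cexp_neg_mul j hre).const_mul _
  have hcongr : Set.EqOn (fun w : ℝ => divisorRemainder k a w * Complex.exp (-s * w))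
      (fun w : ℝ => (∑ n ∈ Finset.Icc 1 ⌊Real.exp w⌋₊, (divisorFn k n : ℂ)) *
        Complex.exp (-s * w) - ∑ j ∈ Finset.range k, a j / j.factorial *
          ((w : ℂ) ^ j * Complex.exp (-(s - 1) * w))) (Set.Ioi 0) := by
    intro w hw
    simp only []
    rw [divisorRemainder, if_neg (not_lt.2 (le_of_lt hw)), sub_mul, mul_right_comm,
      ← Complex.exp_add, Finset.mul_sum]
    congr 1
    refine Finset.sum_congr rfl fun j _ => ?_
    rw [show (w : ℂ) + -s * w = -(s - 1) * w by ring]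
    ring
  rw [MeasureTheory.setIntegral_congr_fun measurableSet_Ioi hcongr, MeasureTheory.integral_sub,
    integral_sum_divisorFn_mul_cexp k hs, MeasureTheory.integral_finsetSum _ hmi,
    h s (by linarith) hs1]
  · rw [add_comm, add_sub_assoc, add_eq_left, sub_eq_zero]
    refine Finset.sum_congr rfl fun j _ => ?_
    rw [MeasureTheory.integral_const_mul, integral_pow_mul_cexp_neg_mul j hre]
    have hf : (j.factorial : ℂ) ≠ 0 := by exact_mod_cast j.factorial_ne_zero
    field_simp
  · refine integrableOn_Ioi_of_norm_le_exp (C := 1) (b := k + 2) ?_ (fun w hw => ?_) hs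
    · exact (Measurable.of_discrete (f := fun N : ℕ =>
        ∑ n ∈ Finset.Icc 1 N, (divisorFn k n : ℂ))).comp
          (Nat.measurable_floor.comp Real.measurable_exp)
    · rw [one_mul]
      exact sum_divisorFn_exp_le hw.le
  · exact MeasureTheory.integrable_finsetSum _ hmi

/-! ### A Plancherel inequality -/

theorem lintegral_le_of_ae_tendsto {f : ℕ → ℝ → ENNReal} {g : ℝ → ENNReal} {C : ENNReal}
    (hf : ∀ n, Measurable (f n))
    (hlim : ∀ᵐ x : ℝ, Tendsto (fun n => f n x) atTop (nhds (g x)))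
    (hC : ∀ n, ∫⁻ x, f n x ≤ C) : ∫⁻ x, g x ≤ C := by
  calc ∫⁻ x, g x = ∫⁻ x, liminf (fun n => f n x) atTop :=
        MeasureTheory.lintegral_congr_ae (hlim.mono fun x hx => hx.liminf_eq.symm)
    _ ≤ liminf (fun n => ∫⁻ x, f n x) atTop := MeasureTheory.lintegral_liminf_le hf
    _ ≤ C := liminf_le_of_frequently_le' (Frequently.of_forall hC)

theorem integral_gaussian_mul_cexp {δ : ℝ} (hδ : 0 < δ) (v : ℝ) :
    ∫ u : ℝ, (Real.exp (-δ * u ^ 2) : ℂ) * Complex.exp (Complex.I * v * u) =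
      (Real.sqrt (Real.pi / δ) * Real.exp (-(1 / (4 * δ)) * v ^ 2) : ℝ) := by
  have h := integral_cexp_quadratic (b := (-δ : ℂ)) (by simpa using hδ) (Complex.I * v) 0
  have e : ∀ u : ℝ, (Real.exp (-δ * u ^ 2) : ℂ) * Complex.exp (Complex.I * v * u) =
      Complex.exp (-δ * u ^ 2 + Complex.I * v * u + 0) := by
    intro u
    push_cast
    rw [← Complex.exp_add, add_zero]
  simp_rw [e]
  rw [h, Real.sqrt_eq_rpow, neg_neg]
  push_cast
  rw [Complex.ofReal_cpow (by positivity)]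
  congr 1
  · push_cast
    rfl
  · congr 1
    have : (δ : ℂ) ≠ 0 := by exact_mod_cast hδ.ne'
    field_simp
    rw [Complex.I_sq]
    ring

theorem lintegral_gaussian_kernel {δ : ℝ} (hδ : 0 < δ) (t : ℝ) :
    ∫⁻ v : ℝ, ENNReal.ofReal
      (Real.sqrt (Real.pi / δ) * Real.exp (-(1 / (4 * δ)) * (t - v) ^ 2)) =
      ENNReal.ofReal (2 * Real.pi) := by
  have h4 : 0 < 1 / (4 * δ) := by positivity
  rw [MeasureTheory.lintegral_sub_left_eq_self (fun v => ENNReal.ofReal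
      (Real.sqrt (Real.pi / δ) * Real.exp (-(1 / (4 * δ)) * v ^ 2))) t,
    ← MeasureTheory.ofReal_integral_eq_lintegral_ofReal
      ((integrable_exp_neg_mul_sq h4).const_mul _) (Eventually.of_forall fun _ => by positivity),
    MeasureTheory.integral_const_mul, integral_gaussian, ← Real.sqrt_mul (by positivity)]
  congr 1
  rw [show Real.pi / δ * (Real.pi / (1 / (4 * δ))) = (2 * Real.pi) ^ 2 by field_simp; ring]
  exact Real.sqrt_sq (by positivity)

theorem continuous_fourier_integral {F : ℝ → ℂ} (hF : MeasureTheory.Integrable F) :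
    Continuous fun u : ℝ => ∫ t : ℝ, F t * Complex.exp (Complex.I * t * u) := by
  refine MeasureTheory.continuous_of_dominated (bound := fun t => ‖F t‖) ?_ ?_ hF.norm ?_
  · intro u
    exact hF.1.mul (Continuous.aestronglyMeasurable (by fun_prop))
  · intro u
    refine Eventually.of_forall fun t => ?_
    rw [norm_mul, Complex.norm_exp]
    simp
  · refine Eventually.of_forall fun t => ?_
    fun_prop

theorem norm_cexp_I_mul (t u : ℝ) : ‖Complex.exp (Complex.I * t * u)‖ = 1 := by
  rw [Complex.norm_exp]
  simp

/-- Write the squared transform as a double integral and integrate the Gaussian in `u` first: a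
positive kernel `K(t - t')` of mass `2π` appears. The inequality `|F(t)F(t')| ≤ (|F(t)|² +
|F(t')|²)/2` then finishes as in Schur's test, with a constant free of `δ`. -/
theorem lintegral_fourier_mul_gaussian_le {F : ℝ → ℂ} (hF : MeasureTheory.Integrable F) {δ : ℝ}
    (hδ : 0 < δ) :
    ∫⁻ u : ℝ, ENNReal.ofReal
      (‖∫ t : ℝ, F t * Complex.exp (Complex.I * t * u)‖ ^ 2 * Real.exp (-δ * u ^ 2)) ≤
      ENNReal.ofReal (2 * Real.pi) * ∫⁻ t, ENNReal.ofReal (‖F t‖ ^ 2) := by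
  set Fh : ℝ → ℂ := fun u => ∫ t : ℝ, F t * Complex.exp (Complex.I * t * u) with hFh
  set K : ℝ → ℝ := fun v => Real.sqrt (Real.pi / δ) * Real.exp (-(1 / (4 * δ)) * v ^ 2) with hK
  have hK0 : ∀ v, 0 ≤ K v := fun v => by positivity
  have hKc : Continuous K := by fun_prop
  have hg : MeasureTheory.Integrable fun u : ℝ => Real.exp (-δ * u ^ 2) :=
    integrable_exp_neg_mul_sq hδ
  have hFhb : ∀ u, ‖Fh u‖ ≤ ∫ t, ‖F t‖ := by
    intro u
    refine MeasureTheory.norm_integral_le_of_norm_le hF.norm (Eventually.of_forall fun t => ?_)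
    rw [norm_mul, norm_cexp_I_mul, mul_one]
  have hFhc : Continuous Fh := continuous_fourier_integral hF
  have hint : MeasureTheory.Integrable fun u => ‖Fh u‖ ^ 2 * Real.exp (-δ * u ^ 2) := by
    refine MeasureTheory.Integrable.mono' (hg.const_mul ((∫ t, ‖F t‖) ^ 2))
      (Continuous.aestronglyMeasurable (by fun_prop)) (Eventually.of_forall fun u => ?_)
    rw [Real.norm_of_nonneg (by positivity)]
    exact mul_le_mul_of_nonneg_right (pow_le_pow_left₀ (norm_nonneg _) (hFhb u) 2)
      (Real.exp_pos _).le
  have hFc : MeasureTheory.Integrable fun t => (starRingEnd ℂ) (F t) :=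
    (Complex.conjLIE.toContinuousLinearEquiv.toContinuousLinearMap).integrable_comp hF
  have hFF : MeasureTheory.Integrable (fun p : ℝ × ℝ => F p.1 * (starRingEnd ℂ) (F p.2))
      (MeasureTheory.volume.prod MeasureTheory.volume) := hF.mul_prod hFc
  have hsq : ∀ u : ℝ, ((‖Fh u‖ ^ 2 * Real.exp (-δ * u ^ 2) : ℝ) : ℂ) =
      ∫ p : ℝ × ℝ, (F p.1 * (starRingEnd ℂ) (F p.2)) *
        ((Real.exp (-δ * u ^ 2) : ℂ) * Complex.exp (Complex.I * (p.1 - p.2 : ℝ) * u)) := by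
    intro u
    have h1 : (starRingEnd ℂ) (Fh u) =
        ∫ t : ℝ, (starRingEnd ℂ) (F t) * Complex.exp (-(Complex.I * t * u)) := by
      rw [hFh, ← integral_conj]
      congr 1
      ext t
      rw [map_mul, ← Complex.exp_conj]
      simp
    push_cast
    rw [← Complex.mul_conj', h1, ← MeasureTheory.integral_prod_mul, mul_comm,
      ← MeasureTheory.integral_const_mul]
    congr 1
    ext p
    have : Complex.exp (Complex.I * (p.1 - p.2) * u) =
        Complex.exp (Complex.I * p.1 * u) * Complex.exp (-(Complex.I * p.2 * u)) := by
      rw [← Complex.exp_add]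
      ring_nf
    rw [this]
    ring
  have hswap : ((∫ u, ‖Fh u‖ ^ 2 * Real.exp (-δ * u ^ 2) : ℝ) : ℂ) =
      ∫ p : ℝ × ℝ, (F p.1 * (starRingEnd ℂ) (F p.2)) * (K (p.1 - p.2) : ℂ) := by
    rw [← integral_complex_ofReal]
    simp_rw [hsq]
    rw [MeasureTheory.integral_integral_swap]
    · congr 1
      ext p
      rw [MeasureTheory.integral_const_mul, integral_gaussian_mul_cexp hδ]
    · have h2 : MeasureTheory.Integrable (fun q : ℝ × (ℝ × ℝ) =>
          (Real.exp (-δ * q.1 ^ 2) : ℂ) * (F q.2.1 * (starRingEnd ℂ) (F q.2.2)))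
          (MeasureTheory.volume.prod MeasureTheory.volume) :=
        MeasureTheory.Integrable.mul_prod hg.ofReal hFF
      refine MeasureTheory.Integrable.congr (h2.bdd_mul (c := 1)
        (f := fun q : ℝ × (ℝ × ℝ) => Complex.exp (Complex.I * (q.2.1 - q.2.2 : ℝ) * q.1))
        (Continuous.aestronglyMeasurable (by fun_prop))
        (Eventually.of_forall fun q => (norm_cexp_I_mul _ _).le)) (Eventually.of_forall fun q => ?_)
      simp only [Function.uncurry]
      ring
  have hm1 : AEMeasurable (fun p : ℝ × ℝ => ENNReal.ofReal (‖F p.1‖ ^ 2 * K (p.1 - p.2)))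
      (MeasureTheory.volume.prod MeasureTheory.volume) :=
    ((hF.1.comp_fst.norm.aemeasurable.pow_const 2).mul
      (Continuous.aemeasurable (by fun_prop))).ennreal_ofReal
  have hbound : ∫⁻ p : ℝ × ℝ, ENNReal.ofReal (‖F p.1‖ ^ 2 * K (p.1 - p.2)) =
      ENNReal.ofReal (2 * Real.pi) * ∫⁻ t, ENNReal.ofReal (‖F t‖ ^ 2) := by
    rw [MeasureTheory.Measure.volume_eq_prod, MeasureTheory.lintegral_prod _ hm1]
    · rw [← MeasureTheory.lintegral_const_mul'' _ (by
        exact (hF.1.norm.aemeasurable.pow_const 2).ennreal_ofReal)]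
      refine MeasureTheory.lintegral_congr fun t => ?_
      simp_rw [ENNReal.ofReal_mul (sq_nonneg ‖F t‖)]
      rw [MeasureTheory.lintegral_const_mul _ (by fun_prop), lintegral_gaussian_kernel hδ, mul_comm]
  have hbound' : ∫⁻ p : ℝ × ℝ, ENNReal.ofReal (‖F p.2‖ ^ 2 * K (p.1 - p.2)) =
      ENNReal.ofReal (2 * Real.pi) * ∫⁻ t, ENNReal.ofReal (‖F t‖ ^ 2) := by
    rw [← hbound, MeasureTheory.Measure.volume_eq_prod, ← MeasureTheory.lintegral_prod_swap]
    refine MeasureTheory.lintegral_congr fun p => ?_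
    simp only [Prod.fst_swap, Prod.snd_swap, hK]
    rw [← neg_sub p.1 p.2, neg_sq]
  rw [← MeasureTheory.ofReal_integral_eq_lintegral_ofReal hint
    (Eventually.of_forall fun u => by positivity)]
  have hre : ∫ u, ‖Fh u‖ ^ 2 * Real.exp (-δ * u ^ 2) =
      ‖∫ p : ℝ × ℝ, (F p.1 * (starRingEnd ℂ) (F p.2)) * (K (p.1 - p.2) : ℂ)‖ := by
    rw [← hswap, Complex.norm_real, Real.norm_of_nonneg]
    exact MeasureTheory.integral_nonneg fun u => by positivity
  rw [hre, ofReal_norm]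
  refine (MeasureTheory.enorm_integral_le_lintegral_enorm _).trans ?_
  have hpt : ∀ p : ℝ × ℝ, ‖(F p.1 * (starRingEnd ℂ) (F p.2)) * (K (p.1 - p.2) : ℂ)‖ₑ ≤
      ENNReal.ofReal (1 / 2) * (ENNReal.ofReal (‖F p.1‖ ^ 2 * K (p.1 - p.2)) +
        ENNReal.ofReal (‖F p.2‖ ^ 2 * K (p.1 - p.2))) := by
    intro p
    have := hK0 (p.1 - p.2)
    rw [← ENNReal.ofReal_add (by positivity) (by positivity),
      ← ENNReal.ofReal_mul (by norm_num), ← ofReal_norm]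
    refine ENNReal.ofReal_le_ofReal ?_
    rw [norm_mul, norm_mul, Complex.norm_real, Real.norm_of_nonneg this, RCLike.norm_conj,
      ← add_mul, ← mul_assoc (1 / 2 : ℝ)]
    refine mul_le_mul_of_nonneg_right ?_ this
    nlinarith [sq_nonneg (‖F p.1‖ - ‖F p.2‖)]
  refine (MeasureTheory.lintegral_mono hpt).trans ?_
  rw [MeasureTheory.lintegral_const_mul', MeasureTheory.lintegral_add_left', hbound, hbound',
    ← two_mul, ← mul_assoc, ← ENNReal.ofReal_ofNat 2, ← ENNReal.ofReal_mul (by norm_num)]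
  · norm_num
  · exact hm1
  · exact ENNReal.ofReal_ne_top

theorem lintegral_norm_fourier_sq_le {F : ℝ → ℂ} (hF : MeasureTheory.Integrable F) :
    ∫⁻ u : ℝ, ENNReal.ofReal (‖∫ t : ℝ, F t * Complex.exp (Complex.I * t * u)‖ ^ 2) ≤
      ENNReal.ofReal (2 * Real.pi) * ∫⁻ t, ENNReal.ofReal (‖F t‖ ^ 2) := by
  have hc := continuous_fourier_integral hF
  refine lintegral_le_of_ae_tendsto (f := fun n u => ENNReal.ofReal
    (‖∫ t : ℝ, F t * Complex.exp (Complex.I * t * u)‖ ^ 2 *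
      Real.exp (-(1 / ((n : ℝ) + 1)) * u ^ 2))) (fun n => ?_) ?_
    (fun n => lintegral_fourier_mul_gaussian_le hF (by positivity))
  · exact (Continuous.measurable (by fun_prop)).ennreal_ofReal
  · refine Eventually.of_forall fun u => ENNReal.tendsto_ofReal ?_
    have h0 : Tendsto (fun n : ℕ => Real.exp (-(1 / ((n : ℝ) + 1)) * u ^ 2)) atTop
        (nhds (Real.exp (-0 * u ^ 2))) :=
      (Real.continuous_exp.tendsto _).comp
        ((tendsto_one_div_add_atTop_nhds_zero_nat.neg).mul_const _)
    simpa using h0.const_mul (‖∫ t : ℝ, F t * Complex.exp (Complex.I * t * u)‖ ^ 2)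

/-! ### Shifting vertical lines -/

/-- Cauchy on rectangles of height `2n`; the uniform majorant `m` kills the horizontal sides as `n →
∞`. -/
theorem integral_vertical_eq_of_norm_le {G : ℂ → ℂ} {a b : ℝ} (hab : a ≤ b)
    (hG : DifferentiableOn ℂ G (Set.Icc a b ×ℂ Set.univ)) {m : ℝ → ℝ}
    (hm : MeasureTheory.Integrable m) (hm1 : Tendsto m atTop (nhds 0))
    (hm2 : Tendsto m atBot (nhds 0))
    (hle : ∀ x ∈ Set.Icc a b, ∀ y : ℝ, ‖G (x + y * Complex.I)‖ ≤ m y) :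
    ∫ y : ℝ, G (a + y * Complex.I) = ∫ y : ℝ, G (b + y * Complex.I) := by
  have hcont : ∀ x ∈ Set.Icc a b, Continuous fun y : ℝ => G (x + y * Complex.I) := by
    intro x hx
    refine hG.continuousOn.comp_continuous (by fun_prop) fun y => ?_
    simpa [Complex.mem_reProdIm] using hx
  have hint : ∀ x ∈ Set.Icc a b, MeasureTheory.Integrable fun y : ℝ => G (x + y * Complex.I) :=
    fun x hx => hm.mono' (hcont x hx).aestronglyMeasurable (Eventually.of_forall (hle x hx))
  have htop : Tendsto (fun n : ℕ => (n : ℝ)) atTop atTop := tendsto_natCast_atTop_atTop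
  have hbot : Tendsto (fun n : ℕ => -(n : ℝ)) atTop atBot := tendsto_neg_atTop_atBot.comp htop
  have hv : ∀ x ∈ Set.Icc a b, Tendsto (fun n : ℕ => ∫ y in (-(n : ℝ))..n, G (x + y * Complex.I))
      atTop (nhds (∫ y : ℝ, G (x + y * Complex.I))) := fun x hx =>
    MeasureTheory.intervalIntegral_tendsto_integral (hint x hx) hbot htop
  have hh : ∀ φ : ℕ → ℝ, Tendsto (fun n => m (φ n)) atTop (nhds 0) →
      Tendsto (fun n : ℕ => ∫ x in a..b, G (x + φ n * Complex.I)) atTop (nhds 0) := by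
    intro φ hφ
    refine squeeze_zero_norm (a := fun n => m (φ n) * |b - a|) (fun n => ?_)
      (by simpa using hφ.mul_const |b - a|)
    refine intervalIntegral.norm_integral_le_of_norm_le_const fun x hx => hle x ?_ _
    rw [Set.uIoc_of_le hab] at hx
    exact Set.Ioc_subset_Icc_self hx
  have hrect : ∀ n : ℕ, (∫ x in a..b, G (x + (-(n : ℝ) : ℝ) * Complex.I)) -
      (∫ x in a..b, G (x + (n : ℝ) * Complex.I)) +
      Complex.I • (∫ y in (-(n : ℝ))..n, G (b + y * Complex.I)) -
      Complex.I • (∫ y in (-(n : ℝ))..n, G (a + y * Complex.I)) = 0 := by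
    intro n
    have := Complex.integral_boundary_rect_eq_zero_of_differentiableOn G
      (⟨a, -(n : ℝ)⟩ : ℂ) (⟨b, n⟩ : ℂ) (hG.mono ?_)
    · exact this
    · intro z hz
      rw [Complex.mem_reProdIm] at hz ⊢
      rw [Set.uIcc_of_le hab] at hz
      exact ⟨hz.1, trivial⟩
  have hlim := (((hh _ (hm2.comp hbot)).sub (hh _ (hm1.comp htop))).add
    ((hv b ⟨hab, le_rfl⟩).const_smul Complex.I)).sub ((hv a ⟨le_rfl, hab⟩).const_smul Complex.I)
  have h0 := tendsto_nhds_unique (hlim.congr hrect) tendsto_const_nhds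
  rw [sub_zero, zero_add, ← smul_sub] at h0
  exact (sub_eq_zero.1 ((smul_eq_zero.1 h0).resolve_left Complex.I_ne_zero)).symm

theorem mul_abs_sub_mul_sq_le {δ : ℝ} (hδ : 0 < δ) (A y : ℝ) :
    A * |y| - δ * y ^ 2 ≤ A ^ 2 / (2 * δ) + -(δ / 2) * y ^ 2 := by
  have h : 0 ≤ (δ / 2) * (|y| - A / δ) ^ 2 := by positivity
  have e : (δ / 2) * (|y| - A / δ) ^ 2 = (δ / 2) * y ^ 2 - A * |y| + A ^ 2 / (2 * δ) := by
    rw [sub_sq, sq_abs]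
    field_simp
  linarith

theorem tendsto_exp_neg_mul_sq_cocompact {δ : ℝ} (hδ : 0 < δ) (C : ℝ) :
    Tendsto (fun y : ℝ => C * Real.exp (-δ * y ^ 2)) (cocompact ℝ) (nhds 0) := by
  have h1 : Tendsto (fun y : ℝ => δ * ‖y‖ ^ 2) (cocompact ℝ) atTop :=
    (tendsto_pow_atTop two_ne_zero |>.comp (tendsto_norm_cocompact_atTop)).const_mul_atTop hδ
  have h2 := (Real.tendsto_exp_neg_atTop_nhds_zero.comp h1).const_mul C
  rw [mul_zero] at h2
  refine h2.congr fun y => ?_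
  simp

/-- The Gaussian factor `e^{δs² + su}` on a vertical strip. -/
theorem norm_mul_cexp_quadratic_le {H : ℂ → ℂ} {σ c B A : ℝ}
    (hHle : ∀ x ∈ Set.Icc σ c, ∀ y : ℝ, ‖H (x + y * Complex.I)‖ ≤ B * Real.exp (A * |y|))
    {δ : ℝ} (hδ : 0 < δ) (u : ℝ) :
    ∃ C : ℝ, ∀ x ∈ Set.Icc σ c, ∀ y : ℝ,
      ‖H (x + y * Complex.I) * Complex.exp (δ * (x + y * Complex.I) ^ 2 +
        (x + y * Complex.I) * u)‖ ≤ C * Real.exp (-(δ / 2) * y ^ 2) := by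
  set R := max |σ| |c|
  refine ⟨|B| * Real.exp (A ^ 2 / (2 * δ)) * Real.exp (δ * R ^ 2 + R * |u|), fun x hx y => ?_⟩
  have hxR : |x| ≤ R := abs_le_max_abs_abs hx.1 hx.2
  have hre : (δ * ((x : ℂ) + y * Complex.I) ^ 2 + (x + y * Complex.I) * u).re =
      δ * x ^ 2 - δ * y ^ 2 + x * u := by
    simp [sq]
    ring
  rw [norm_mul, Complex.norm_exp, hre]
  have h1 : ‖H (x + y * Complex.I)‖ ≤ |B| * Real.exp (A * |y|) :=
    (hHle x hx y).trans (mul_le_mul_of_nonneg_right (le_abs_self B) (Real.exp_pos _).le)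
  have h2 : δ * x ^ 2 ≤ δ * R ^ 2 := by
    refine mul_le_mul_of_nonneg_left ?_ hδ.le
    rw [← sq_abs x]
    exact pow_le_pow_left₀ (abs_nonneg x) hxR 2
  have h3 : x * u ≤ R * |u| := by
    calc x * u ≤ |x * u| := le_abs_self _
      _ = |x| * |u| := abs_mul _ _
      _ ≤ R * |u| := mul_le_mul_of_nonneg_right hxR (abs_nonneg u)
  have h4 := mul_abs_sub_mul_sq_le hδ A y
  calc ‖H (x + y * Complex.I)‖ * Real.exp (δ * x ^ 2 - δ * y ^ 2 + x * u)
      ≤ |B| * Real.exp (A * |y|) * Real.exp (δ * x ^ 2 - δ * y ^ 2 + x * u) :=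
        mul_le_mul_of_nonneg_right h1 (Real.exp_pos _).le
    _ = |B| * Real.exp (A * |y| + (δ * x ^ 2 - δ * y ^ 2 + x * u)) := by
        rw [mul_assoc, ← Real.exp_add]
    _ ≤ |B| * Real.exp (A ^ 2 / (2 * δ) + (δ * R ^ 2 + R * |u|) + -(δ / 2) * y ^ 2) :=
        mul_le_mul_of_nonneg_left (Real.exp_le_exp.2 (by linarith)) (abs_nonneg B)
    _ = _ := by rw [Real.exp_add, Real.exp_add]; ring

theorem integral_vertical_mul_cexp_quadratic_eq {H : ℂ → ℂ} {σ c B A : ℝ} (hσc : σ ≤ c)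
    (hH : DifferentiableOn ℂ H (Set.Icc σ c ×ℂ Set.univ))
    (hHle : ∀ x ∈ Set.Icc σ c, ∀ y : ℝ, ‖H (x + y * Complex.I)‖ ≤ B * Real.exp (A * |y|))
    {δ : ℝ} (hδ : 0 < δ) (u : ℝ) :
    ∫ y : ℝ, H (σ + y * Complex.I) * Complex.exp (δ * (σ + y * Complex.I) ^ 2 +
        (σ + y * Complex.I) * u) =
      ∫ y : ℝ, H (c + y * Complex.I) * Complex.exp (δ * (c + y * Complex.I) ^ 2 +
        (c + y * Complex.I) * u) := by
  obtain ⟨C, hC⟩ := norm_mul_cexp_quadratic_le hHle hδ u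
  have hlim := tendsto_exp_neg_mul_sq_cocompact (half_pos hδ) C
  exact integral_vertical_eq_of_norm_le
    (G := fun s => H s * Complex.exp (δ * s ^ 2 + s * u)) hσc
    (hH.mul (Differentiable.differentiableOn (by fun_prop)))
    ((integrable_exp_neg_mul_sq (half_pos hδ)).const_mul C)
    (hlim.mono_left atTop_le_cocompact) (hlim.mono_left atBot_le_cocompact) hC

/-! ### Gaussian smoothing -/

theorem integral_vertical_cexp_quadratic {δ : ℝ} (hδ : 0 < δ) (c v : ℝ) :
    ∫ y : ℝ, Complex.exp (δ * (c + y * Complex.I) ^ 2 + (c + y * Complex.I) * v) =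
      (Real.sqrt (Real.pi / δ) * Real.exp (-(1 / (4 * δ)) * v ^ 2) : ℝ) := by
  have h := integral_cexp_quadratic (b := (-δ : ℂ)) (by simpa using hδ)
    (Complex.I * (2 * δ * c + v)) (δ * c ^ 2 + c * v)
  have e : ∀ y : ℝ, Complex.exp (δ * (c + y * Complex.I) ^ 2 + (c + y * Complex.I) * v) =
      Complex.exp (-δ * y ^ 2 + Complex.I * (2 * δ * c + v) * y + (δ * c ^ 2 + c * v)) := by
    intro y
    congr 1
    linear_combination (δ * y ^ 2 : ℂ) * Complex.I_sq
  simp_rw [e]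
  rw [h, Real.sqrt_eq_rpow, neg_neg]
  push_cast
  rw [Complex.ofReal_cpow (by positivity)]
  congr 1
  · push_cast
    rfl
  · congr 1
    have : (δ : ℂ) ≠ 0 := by exact_mod_cast hδ.ne'
    field_simp
    linear_combination ((2 * δ * c + v) ^ 2 : ℂ) * Complex.I_sq

/-- By Fubini, Laplace inversion damped by `e^{δs²}` is convolution of `E` with a Gaussian. The
kernel no longer involves `c`. -/
theorem integral_gaussian_smoothing {E : ℝ → ℂ} {H : ℂ → ℂ} {c : ℝ}
    (hE : MeasureTheory.Integrable fun w : ℝ => E w * Complex.exp (-c * w))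
    (hL : ∀ y : ℝ, ∫ w : ℝ, E w * Complex.exp (-(c + y * Complex.I) * w) = H (c + y * Complex.I))
    {δ : ℝ} (hδ : 0 < δ) (u : ℝ) :
    ∫ y : ℝ, H (c + y * Complex.I) * Complex.exp (δ * (c + y * Complex.I) ^ 2 +
        (c + y * Complex.I) * u) =
      ∫ w : ℝ, E w * (Real.sqrt (Real.pi / δ) * Real.exp (-(1 / (4 * δ)) * (u - w) ^ 2) : ℝ) := by
  have hg : MeasureTheory.Integrable fun y : ℝ =>
      Complex.exp (δ * (c + y * Complex.I) ^ 2 + (c + y * Complex.I) * u) := by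
    have hg0 := integrable_exp_neg_mul_sq hδ
    refine MeasureTheory.Integrable.mono' (hg0.const_mul (Real.exp (δ * c ^ 2 + c * u)))
      (Continuous.aestronglyMeasurable (by fun_prop)) (Eventually.of_forall fun y => ?_)
    rw [Complex.norm_exp, ← Real.exp_add]
    refine (congrArg Real.exp ?_).le
    simp [sq]
    ring
  have h1 : ∀ y : ℝ, H (c + y * Complex.I) * Complex.exp (δ * (c + y * Complex.I) ^ 2 +
        (c + y * Complex.I) * u) = ∫ w : ℝ, E w *
          Complex.exp (δ * (c + y * Complex.I) ^ 2 + (c + y * Complex.I) * (u - w : ℝ)) := by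
    intro y
    rw [← hL, ← MeasureTheory.integral_mul_const]
    congr 1
    ext w
    rw [mul_assoc, ← Complex.exp_add]
    congr 2
    push_cast
    ring
  simp_rw [h1]
  rw [MeasureTheory.integral_integral_swap]
  · congr 1
    ext w
    rw [MeasureTheory.integral_const_mul, integral_vertical_cexp_quadratic hδ]
  · refine MeasureTheory.Integrable.congr ((hg.mul_prod hE).bdd_mul (c := 1)
      (f := fun q : ℝ × ℝ => Complex.exp (Complex.I * (-q.1 : ℝ) * q.2))
      (Continuous.aestronglyMeasurable (by fun_prop))
      (Eventually.of_forall fun q => (norm_cexp_I_mul _ _).le)) (Eventually.of_forall fun q => ?_)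
    simp only [Function.uncurry]
    rw [mul_left_comm (Complex.exp _) (E q.2), mul_left_comm (Complex.exp _) (E q.2),
      ← Complex.exp_add, ← Complex.exp_add]
    congr 2
    push_cast
    ring

theorem integral_mul_gaussian_eq_average (E : ℝ → ℂ) {η : ℝ} (hη : 0 < η) (u : ℝ) :
    ∫ w : ℝ, E w * (Real.sqrt (Real.pi / η ^ 2) *
        Real.exp (-(1 / (4 * η ^ 2)) * (u - w) ^ 2) : ℝ) =
      (2 * Real.sqrt Real.pi : ℝ) * ∫ y : ℝ, E (u + 2 * η * y) * (Real.exp (-y ^ 2) : ℂ) := by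
  have h := MeasureTheory.Measure.integral_comp_mul_left (fun x : ℝ => E (u + x) *
    (Real.sqrt (Real.pi / η ^ 2) * Real.exp (-(1 / (4 * η ^ 2)) * x ^ 2) : ℝ)) (2 * η)
  have h2 := MeasureTheory.integral_add_left_eq_self (μ := MeasureTheory.volume)
    (fun w : ℝ => E w * (Real.sqrt (Real.pi / η ^ 2) *
        Real.exp (-(1 / (4 * η ^ 2)) * (u - w) ^ 2) : ℝ)) u
  rw [← h2]
  have h3 : ∀ x : ℝ, (u - (u + x)) ^ 2 = x ^ 2 := fun x => by ring
  simp only [h3]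
  have hη2 : |(2 * η)⁻¹| = (2 * η)⁻¹ := abs_of_pos (by positivity)
  rw [hη2, eq_comm, inv_smul_eq_iff₀ (by positivity)] at h
  rw [h, Real.sqrt_div Real.pi_pos.le, Real.sqrt_sq hη.le, ← MeasureTheory.integral_const_mul,
    Complex.real_smul, ← MeasureTheory.integral_const_mul]
  congr 1
  ext y
  have h4 : -(1 / (4 * η ^ 2)) * (2 * η * y) ^ 2 = -y ^ 2 := by field_simp; ring
  rw [h4]
  have : (η : ℂ) ≠ 0 := by exact_mod_cast hη.ne'
  push_cast
  field_simp

theorem tendsto_gaussian_average {E : ℝ → ℂ} (hE : Measurable E) {C b : ℝ} (hb : 0 ≤ b)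
    (hle : ∀ w, ‖E w‖ ≤ C * Real.exp (b * |w|)) {u : ℝ} (hu : ContinuousAt E u) {η : ℕ → ℝ}
    (hη : Tendsto η atTop (nhds 0)) (hη1 : ∀ n, |η n| ≤ 1) :
    Tendsto (fun n => ∫ y : ℝ, E (u + 2 * η n * y) * (Real.exp (-y ^ 2) : ℂ)) atTop
      (nhds ((Real.sqrt Real.pi : ℂ) * E u)) := by
  have hC : 0 ≤ C := by
    have := (norm_nonneg _).trans (hle 0)
    simpa using this
  have hval : (Real.sqrt Real.pi : ℂ) * E u = ∫ y : ℝ, E u * (Real.exp (-y ^ 2) : ℂ) := by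
    have h := integral_gaussian 1
    rw [div_one] at h
    rw [MeasureTheory.integral_const_mul, integral_complex_ofReal, ← h, mul_comm]
    simp
  rw [hval]
  refine MeasureTheory.tendsto_integral_of_dominated_convergence
    (fun y => C * Real.exp (b * |u| + (2 * b) ^ 2 / 2) * Real.exp (-(1 / 2) * y ^ 2)) ?_ ?_ ?_ ?_
  · intro n
    exact ((hE.comp (Continuous.measurable (by fun_prop))).mul
      (Continuous.measurable (by fun_prop))).aestronglyMeasurable
  · exact (integrable_exp_neg_mul_sq (by norm_num)).const_mul _
  · intro n
    refine Eventually.of_forall fun y => ?_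
    rw [norm_mul, Complex.norm_real, Real.norm_of_nonneg (Real.exp_pos _).le]
    have h1 : |u + 2 * η n * y| ≤ |u| + 2 * |y| := by
      refine (abs_add_le _ _).trans (by
        rw [abs_mul, abs_mul, abs_two]
        nlinarith [hη1 n, abs_nonneg y])
    have h2 := mul_abs_sub_mul_sq_le one_pos (2 * b) y
    calc ‖E (u + 2 * η n * y)‖ * Real.exp (-y ^ 2)
        ≤ C * Real.exp (b * |u + 2 * η n * y|) * Real.exp (-y ^ 2) :=
          mul_le_mul_of_nonneg_right (hle _) (Real.exp_pos _).le
      _ = C * Real.exp (b * |u + 2 * η n * y| + -y ^ 2) := by rw [mul_assoc, ← Real.exp_add]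
      _ ≤ C * Real.exp (b * |u| + (2 * b) ^ 2 / 2 + -(1 / 2) * y ^ 2) :=
          mul_le_mul_of_nonneg_left (Real.exp_le_exp.2 (by nlinarith)) hC
      _ = _ := by rw [Real.exp_add]; ring
  · refine Eventually.of_forall fun y => Tendsto.mul_const _ (hu.tendsto.comp ?_)
    have : Tendsto (fun n => u + 2 * η n * y) atTop (nhds (u + 2 * 0 * y)) :=
      ((hη.const_mul 2).mul_const y).const_add u
    simpa using this

/-- Nothing is assumed about the Laplace integral of `E` on `Re s = σ`. The damped functions `F n`
are integrable there, and moving the line to `c` identifies their Fourier transforms with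
differences of Gaussian averages of `E`. Plancherel for `F n` and Fatou as `η n → 0` give the bound
at almost every point of continuity. -/
theorem lintegral_sq_norm_shift_sub_le {E : ℝ → ℂ} {H : ℂ → ℂ} {σ c A B C b : ℝ} (hσc : σ ≤ c)
    (hE : Measurable E) (hb : 0 ≤ b) (hle : ∀ w, ‖E w‖ ≤ C * Real.exp (b * |w|))
    (hEc : ∀ᵐ w : ℝ, ContinuousAt E w)
    (hEi : MeasureTheory.Integrable fun w : ℝ => E w * Complex.exp (-c * w))
    (hL : ∀ y : ℝ, ∫ w : ℝ, E w * Complex.exp (-(c + y * Complex.I) * w) = H (c + y * Complex.I))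
    (hH : DifferentiableOn ℂ H (Set.Icc σ c ×ℂ Set.univ))
    (hHle : ∀ x ∈ Set.Icc σ c, ∀ y : ℝ, ‖H (x + y * Complex.I)‖ ≤ B * Real.exp (A * |y|))
    (a : ℝ) :
    ∫⁻ u : ℝ, ENNReal.ofReal (‖E (u + a) - E u‖ ^ 2 * Real.exp (-2 * σ * u)) ≤
      ENNReal.ofReal (2 * Real.pi * Real.exp (2 * σ ^ 2)) * ∫⁻ y : ℝ, ENNReal.ofReal
        (‖H (σ + y * Complex.I) * (Complex.exp (a * (σ + y * Complex.I)) - 1)‖ ^ 2) := by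
  set I := ∫⁻ y : ℝ, ENNReal.ofReal
        (‖H (σ + y * Complex.I) * (Complex.exp (a * (σ + y * Complex.I)) - 1)‖ ^ 2) with hI
  set η : ℕ → ℝ := fun n => 1 / ((n : ℝ) + 1) with hηdef
  have hη0 : ∀ n, 0 < η n := fun n => by positivity
  have hη1 : ∀ n, |η n| ≤ 1 := fun n => by
    rw [abs_of_pos (hη0 n)]
    exact div_le_one_of_le₀ (by linarith [Nat.cast_nonneg (α := ℝ) n]) (by positivity)
  have hηlim : Tendsto η atTop (nhds 0) := tendsto_one_div_add_atTop_nhds_zero_nat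
  set F : ℕ → ℝ → ℂ := fun n y => H (σ + y * Complex.I) *
    (Complex.exp (a * (σ + y * Complex.I)) - 1) * Complex.exp ((η n) ^ 2 * (σ + y * Complex.I) ^ 2)
    with hF
  have hHc : Continuous fun y : ℝ => H (σ + y * Complex.I) :=
    hH.continuousOn.comp_continuous (by fun_prop) fun y => by
      simpa [Complex.mem_reProdIm] using hσc
  have hGi : ∀ n (u : ℝ), MeasureTheory.Integrable fun y : ℝ => H (σ + y * Complex.I) *
      Complex.exp (((η n ^ 2 : ℝ) : ℂ) * (σ + y * Complex.I) ^ 2 + (σ + y * Complex.I) * u) := by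
    intro n u
    have hδ : 0 < η n ^ 2 := pow_pos (hη0 n) 2
    obtain ⟨K, hK⟩ := norm_mul_cexp_quadratic_le hHle hδ u
    exact ((integrable_exp_neg_mul_sq (half_pos hδ)).const_mul K).mono'
      (hHc.mul (by fun_prop)).aestronglyMeasurable
      (Eventually.of_forall fun y => hK σ ⟨le_rfl, hσc⟩ y)
  have hsm : ∀ n (u : ℝ), ∫ y : ℝ, H (σ + y * Complex.I) *
      Complex.exp (((η n ^ 2 : ℝ) : ℂ) * (σ + y * Complex.I) ^ 2 + (σ + y * Complex.I) * u) =
      (2 * Real.sqrt Real.pi : ℝ) * ∫ y : ℝ, E (u + 2 * η n * y) * (Real.exp (-y ^ 2) : ℂ) := by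
    intro n u
    have hδ : 0 < η n ^ 2 := pow_pos (hη0 n) 2
    rw [integral_vertical_mul_cexp_quadratic_eq hσc hH hHle hδ u,
      integral_gaussian_smoothing hEi hL hδ u, integral_mul_gaussian_eq_average E (hη0 n) u]
  have hFi : ∀ n, MeasureTheory.Integrable (F n) := by
    intro n
    refine ((hGi n a).sub (hGi n 0)).congr (Eventually.of_forall fun y => ?_)
    simp only [hF, Pi.sub_apply]
    rw [Complex.exp_add, Complex.exp_add, Complex.ofReal_zero, mul_zero, Complex.exp_zero]
    push_cast
    rw [mul_comm (a : ℂ)]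
    ring
  have hFhat : ∀ n (u : ℝ), ∫ y : ℝ, F n y * Complex.exp (Complex.I * y * u) =
      Complex.exp (-σ * u) * (((2 * Real.sqrt Real.pi : ℝ) : ℂ) *
        (∫ y : ℝ, E (u + a + 2 * η n * y) * (Real.exp (-y ^ 2) : ℂ)) -
        ((2 * Real.sqrt Real.pi : ℝ) : ℂ) *
        ∫ y : ℝ, E (u + 2 * η n * y) * (Real.exp (-y ^ 2) : ℂ)) := by
    intro n u
    rw [← hsm, ← hsm, ← MeasureTheory.integral_sub (hGi n _) (hGi n _),
      ← MeasureTheory.integral_const_mul]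
    congr 1
    ext y
    have e1 : Complex.exp (((η n ^ 2 : ℝ) : ℂ) * (σ + y * Complex.I) ^ 2 +
        (σ + y * Complex.I) * (u + a : ℝ)) = Complex.exp ((η n) ^ 2 * (σ + y * Complex.I) ^ 2) *
        Complex.exp (σ * u) * Complex.exp (Complex.I * y * u) *
          Complex.exp (a * (σ + y * Complex.I)) := by
      rw [← Complex.exp_add, ← Complex.exp_add, ← Complex.exp_add]
      congr 1
      push_cast
      ring
    have e2 : Complex.exp (((η n ^ 2 : ℝ) : ℂ) * (σ + y * Complex.I) ^ 2 +
        (σ + y * Complex.I) * u) = Complex.exp ((η n) ^ 2 * (σ + y * Complex.I) ^ 2) *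
        Complex.exp (σ * u) * Complex.exp (Complex.I * y * u) := by
      rw [← Complex.exp_add, ← Complex.exp_add]
      congr 1
      push_cast
      ring
    have e3 : Complex.exp (-σ * u) * Complex.exp (σ * u) = 1 := by
      rw [← Complex.exp_add, neg_mul, neg_add_cancel, Complex.exp_zero]
    rw [e1, e2]
    simp only [hF]
    linear_combination (-(H (σ + y * Complex.I) * (Complex.exp (a * (σ + y * Complex.I)) - 1) *
      Complex.exp ((η n) ^ 2 * (σ + y * Complex.I) ^ 2) * Complex.exp (Complex.I * y * u))) * e3
  have hFle : ∀ n, ∫⁻ y, ENNReal.ofReal (‖F n y‖ ^ 2) ≤ ENNReal.ofReal (Real.exp (2 * σ ^ 2)) * I := by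
    intro n
    rw [hI, ← MeasureTheory.lintegral_const_mul' _ _ ENNReal.ofReal_ne_top]
    refine MeasureTheory.lintegral_mono fun y => ?_
    rw [← ENNReal.ofReal_mul (Real.exp_pos _).le]
    refine ENNReal.ofReal_le_ofReal ?_
    simp only [hF]
    rw [norm_mul _ (Complex.exp ((η n) ^ 2 * _)), mul_pow, mul_comm]
    refine mul_le_mul_of_nonneg_right ?_ (sq_nonneg _)
    -- The damping factor has squared modulus `exp(2η²(σ² - y²)) ≤ exp(2σ²)` since `η ≤ 1`; this is
    -- the source of the constant.
    have hre : (((η n : ℝ) : ℂ) ^ 2 * ((σ : ℂ) + y * Complex.I) ^ 2).re =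
        η n ^ 2 * (σ ^ 2 - y ^ 2) := by
      rw [← Complex.ofReal_pow, Complex.re_ofReal_mul]
      simp [sq]
    rw [Complex.norm_exp, hre, ← Real.exp_nat_mul]
    refine Real.exp_le_exp.2 ?_
    have h1 : η n ^ 2 ≤ 1 := by
      rw [← sq_abs]; exact pow_le_one₀ (abs_nonneg _) (hη1 n)
    have h2 : 0 ≤ η n ^ 2 := sq_nonneg _
    push_cast
    nlinarith [sq_nonneg σ, sq_nonneg y, mul_nonneg h2 (sq_nonneg y),
      mul_nonneg (sub_nonneg.2 h1) (sq_nonneg σ)]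
  have hEc' : ∀ᵐ w : ℝ, ContinuousAt E (w + a) :=
    (MeasureTheory.measurePreserving_add_right MeasureTheory.volume a).quasiMeasurePreserving.ae hEc
  -- The limit carries the factor `2π = 2√π · √π`: the first part comes from rescaling the kernel,
  -- the second from the mass of `e^{-y²}`. It is discarded afterwards, being at least `1`.
  have key : ∫⁻ u : ℝ, ENNReal.ofReal
      (‖Complex.exp (-σ * u) * ((2 * Real.pi : ℝ) * (E (u + a) - E u))‖ ^ 2) ≤
      ENNReal.ofReal (2 * Real.pi) * (ENNReal.ofReal (Real.exp (2 * σ ^ 2)) * I) := by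
    refine lintegral_le_of_ae_tendsto (f := fun n u => ENNReal.ofReal
      (‖∫ y : ℝ, F n y * Complex.exp (Complex.I * y * u)‖ ^ 2)) (fun n => ?_) ?_ (fun n => ?_)
    · have := continuous_fourier_integral (hFi n)
      exact (Continuous.measurable (by fun_prop)).ennreal_ofReal
    · filter_upwards [hEc, hEc'] with u hu hu'
      refine ENNReal.tendsto_ofReal (Tendsto.pow (Tendsto.norm ?_) 2)
      simp_rw [hFhat]
      refine Tendsto.const_mul _ ?_
      have h1 := (tendsto_gaussian_average hE hb hle hu' hηlim hη1).const_mul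
        ((2 * Real.sqrt Real.pi : ℝ) : ℂ)
      have h2 := (tendsto_gaussian_average hE hb hle hu hηlim hη1).const_mul
        ((2 * Real.sqrt Real.pi : ℝ) : ℂ)
      have hpi : ((2 * Real.pi : ℝ) : ℂ) =
          ((2 * Real.sqrt Real.pi : ℝ) : ℂ) * (Real.sqrt Real.pi : ℂ) := by
        rw [← Complex.ofReal_mul, mul_assoc, Real.mul_self_sqrt Real.pi_pos.le]
      rw [hpi, mul_sub, mul_assoc, mul_assoc]
      exact h1.sub h2
    · exact (lintegral_norm_fourier_sq_le (hFi n)).trans (mul_le_mul_right (hFle n) _)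
  rw [ENNReal.ofReal_mul (by positivity), mul_assoc]
  refine le_trans (MeasureTheory.lintegral_mono fun u => ENNReal.ofReal_le_ofReal ?_) key
  have hexp : ‖Complex.exp (-σ * u)‖ ^ 2 = Real.exp (-2 * σ * u) := by
    rw [Complex.norm_exp, ← Real.exp_nat_mul]
    congr 1
    simp
    ring
  rw [norm_mul, norm_mul, mul_pow, hexp, Complex.norm_real, Real.norm_of_nonneg (by positivity),
    mul_comm]
  refine mul_le_mul_of_nonneg_left (pow_le_pow_left₀ (norm_nonneg _) ?_ 2) (Real.exp_pos _).le
  exact le_mul_of_one_le_left (norm_nonneg _) (by linarith [Real.pi_gt_three])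

/-! ### Weighted moments of the zeta function -/

/-- Integration by parts against the primitive of `f`; the remaining integrand is
`O((t+1)^{κ-p-1})`, integrable because `κ < p`. -/
theorem integrableOn_mul_rpow_of_primitive_le {f : ℝ → ℝ} (hf : Continuous f) (hf0 : ∀ t, 0 ≤ f t)
    {C κ p : ℝ} (hp0 : 0 < p) (hp : κ < p)
    (hF : ∀ T, 0 ≤ T → ∫ t in (0 : ℝ)..T, f t ≤ C * (T + 1) ^ κ) :
    MeasureTheory.IntegrableOn (fun t => f t * (t + 1) ^ (-p)) (Set.Ioi 0) := by
  have hC : 0 ≤ C := by simpa using hF 0 le_rfl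
  have hJ : MeasureTheory.IntegrableOn (fun t : ℝ => (t + 1) ^ (κ - p - 1)) (Set.Ioi 0) :=
    integrableOn_add_rpow_Ioi_of_lt (by linarith) (by norm_num)
  have hcr : ∀ r : ℝ, ContinuousOn (fun t : ℝ => (t + 1) ^ r) (Set.Ici 0) := fun r =>
    ContinuousOn.rpow_const (by fun_prop) fun t (ht : 0 ≤ t) => Or.inl (by positivity)
  refine MeasureTheory.integrableOn_Ioi_of_intervalIntegral_norm_bounded
    (l := atTop) (b := fun n : ℕ => (n : ℝ))
    (C + p * C * ∫ t in Set.Ioi (0 : ℝ), (t + 1) ^ (κ - p - 1)) 0 (fun n => ?_)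
    tendsto_natCast_atTop_atTop (Eventually.of_forall fun n => ?_)
  · exact ((hf.continuousOn.mul (hcr (-p))).mono Set.Icc_subset_Ici_self).integrableOn_Icc.mono_set
      Set.Ioc_subset_Icc_self
  set T : ℝ := (n : ℝ)
  have hT : 0 ≤ T := by positivity
  have hsub : Set.uIcc 0 T ⊆ Set.Ici 0 := by
    rw [Set.uIcc_of_le hT]; exact Set.Icc_subset_Ici_self
  have hparts := intervalIntegral.integral_mul_deriv_eq_deriv_mul (a := 0) (b := T)
    (u := fun t : ℝ => (t + 1) ^ (-p)) (u' := fun t => -p * (t + 1) ^ (-p - 1))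
    (v := fun t => ∫ x in (0 : ℝ)..t, f x) (v' := f)
    (fun t ht => by
      have h0 : (0 : ℝ) ≤ t := hsub ht
      have := ((hasDerivAt_id t).add_const 1).rpow_const (p := -p) (Or.inl (by
        simp only [id]; positivity))
      simpa using this)
    (fun t _ => hf.integral_hasStrictDerivAt 0 t |>.hasDerivAt)
    ((continuousOn_const.mul ((hcr (-p - 1)).mono hsub)).intervalIntegrable)
    (hf.intervalIntegrable _ _)
  have hnorm : ∫ t in (0 : ℝ)..T, ‖f t * (t + 1) ^ (-p)‖ =
      ∫ t in (0 : ℝ)..T, (t + 1) ^ (-p) * f t := by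
    refine intervalIntegral.integral_congr fun t ht => ?_
    have h0 : (0 : ℝ) ≤ t := hsub ht
    rw [Real.norm_of_nonneg (mul_nonneg (hf0 t) (by positivity)), mul_comm]
  rw [hnorm, hparts]
  have hb1 : (T + 1) ^ (-p) * ∫ x in (0 : ℝ)..T, f x ≤ C := by
    calc (T + 1) ^ (-p) * ∫ x in (0 : ℝ)..T, f x ≤ (T + 1) ^ (-p) * (C * (T + 1) ^ κ) :=
          mul_le_mul_of_nonneg_left (hF T hT) (by positivity)
      _ = C * (T + 1) ^ (κ - p) := by
          rw [mul_left_comm, ← Real.rpow_add (by positivity), neg_add_eq_sub]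
      _ ≤ C * 1 := mul_le_mul_of_nonneg_left
          (Real.rpow_le_one_of_one_le_of_nonpos (by linarith) (by linarith)) hC
      _ = C := mul_one C
  have hprim : Continuous fun t => ∫ x in (0 : ℝ)..t, f x :=
    intervalIntegral.continuous_primitive (fun a b => hf.intervalIntegrable a b) 0
  have hb2 : -(∫ t in (0 : ℝ)..T, -p * (t + 1) ^ (-p - 1) * ∫ x in (0 : ℝ)..t, f x) ≤
      p * C * ∫ t in Set.Ioi (0 : ℝ), (t + 1) ^ (κ - p - 1) := by
    rw [← intervalIntegral.integral_neg]
    calc ∫ t in (0 : ℝ)..T, -(-p * (t + 1) ^ (-p - 1) * ∫ x in (0 : ℝ)..t, f x)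
        ≤ ∫ t in (0 : ℝ)..T, p * C * (t + 1) ^ (κ - p - 1) := by
          refine intervalIntegral.integral_mono_on hT ?_ ?_ fun t ht => ?_
          · exact ContinuousOn.intervalIntegrable ((continuousOn_const.mul
              ((hcr (-p - 1)).mono hsub)).mul hprim.continuousOn).neg
          · exact ContinuousOn.intervalIntegrable (continuousOn_const.mul ((hcr _).mono hsub))
          · have h0 : (0 : ℝ) ≤ t := ht.1
            calc -(-p * (t + 1) ^ (-p - 1) * ∫ x in (0 : ℝ)..t, f x)
                = p * (t + 1) ^ (-p - 1) * ∫ x in (0 : ℝ)..t, f x := by ring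
              _ ≤ p * (t + 1) ^ (-p - 1) * (C * (t + 1) ^ κ) :=
                mul_le_mul_of_nonneg_left (hF t h0) (by positivity)
              _ = p * C * ((t + 1) ^ (-p - 1) * (t + 1) ^ κ) := by ring
              _ = p * C * (t + 1) ^ (κ - p - 1) := by
                rw [← Real.rpow_add (by positivity)]; ring_nf
      _ = p * C * ∫ t in (0 : ℝ)..T, (t + 1) ^ (κ - p - 1) :=
          intervalIntegral.integral_const_mul _ _
      _ ≤ _ := by
          refine mul_le_mul_of_nonneg_left ?_ (by positivity)
          rw [intervalIntegral.integral_of_le hT]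
          refine MeasureTheory.setIntegral_mono_set hJ ?_ Set.Ioc_subset_Ioi_self.eventuallyLE
          filter_upwards [MeasureTheory.ae_restrict_mem measurableSet_Ioi] with t ht
          have : (0 : ℝ) < t := ht
          exact Real.rpow_nonneg (by linarith) _
  simp only [intervalIntegral.integral_same, mul_zero, sub_zero]
  linarith

theorem continuous_riemannZeta_vertical {σ : ℝ} (hσ : σ ≠ 1) :
    Continuous fun t : ℝ => riemannZeta (σ + t * Complex.I) := by
  refine continuous_iff_continuousAt.2 fun t => ?_
  have h1 : (σ : ℂ) + t * Complex.I ≠ 1 := by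
    intro h
    have := congrArg Complex.re h
    simp at this
    exact hσ this
  exact (differentiableAt_riemannZeta h1).continuousAt.comp
    (f := fun t : ℝ => (σ : ℂ) + t * Complex.I) (by fun_prop)

theorem norm_riemannZeta_vertical_neg (σ t : ℝ) :
    ‖riemannZeta (σ + (-t : ℝ) * Complex.I)‖ = ‖riemannZeta (σ + t * Complex.I)‖ := by
  have : (σ : ℂ) + (-t : ℝ) * Complex.I = (starRingEnd ℂ) (σ + t * Complex.I) := by
    simp
  rw [this, riemannZeta_conj, RCLike.norm_conj]

theorem IsAdmissibleSigma.integrable_weighted_moment {k : ℕ} {σ : ℝ} (h : IsAdmissibleSigma k σ)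
    {η : ℝ} (hη : 0 < η) :
    MeasureTheory.Integrable fun t : ℝ =>
      ‖riemannZeta (σ + t * Complex.I)‖ ^ (2 * k) * (|t| + 1) ^ (-(1 + η)) := by
  obtain ⟨_, h1, hO⟩ := h
  set f : ℝ → ℝ := fun t => ‖riemannZeta (σ + t * Complex.I)‖ ^ (2 * k) with hf
  have hfc : Continuous f := (continuous_riemannZeta_vertical h1.ne).norm.pow _
  have hf0 : ∀ t, 0 ≤ f t := fun t => by positivity
  -- Half of `η` is spent on the moment bound, leaving the other half for convergence.
  obtain ⟨C, hC⟩ := (hO (η / 2) (half_pos hη)).bound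
  obtain ⟨T₀, hT₀⟩ := eventually_atTop.1 hC
  set T₁ := max T₀ 0
  have hmono : ∀ S T, 0 ≤ S → S ≤ T → ∫ t in (0 : ℝ)..S, f t ≤ ∫ t in (0 : ℝ)..T, f t := by
    intro S T hS hST
    exact intervalIntegral.integral_mono_interval le_rfl hS hST (Eventually.of_forall hf0)
      (hfc.intervalIntegrable _ _)
  have hI0 : 0 ≤ ∫ t in (0 : ℝ)..T₁, f t :=
    intervalIntegral.integral_nonneg (le_max_right _ _) fun t _ => hf0 t
  have hbound : ∀ T, 0 ≤ T →
      ∫ t in (0 : ℝ)..T, f t ≤ (|C| + ∫ t in (0 : ℝ)..T₁, f t) * (T + 1) ^ (1 + η / 2) := by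
    intro T hT
    have hT1 : 1 ≤ (T + 1) ^ (1 + η / 2) := Real.one_le_rpow (by linarith) (by linarith)
    rcases le_total T T₁ with h | h
    · calc _ ≤ ∫ t in (0 : ℝ)..T₁, f t := hmono T T₁ hT h
        _ ≤ (|C| + ∫ t in (0 : ℝ)..T₁, f t) * 1 := by linarith [abs_nonneg C]
        _ ≤ _ := mul_le_mul_of_nonneg_left hT1 (by positivity)
    · have h2 := hT₀ T ((le_max_left _ _).trans h)
      rw [Real.norm_of_nonneg (Real.rpow_nonneg hT _)] at h2
      calc _ ≤ C * T ^ (1 + η / 2) := (Real.le_norm_self _).trans h2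
        _ ≤ (|C| + ∫ t in (0 : ℝ)..T₁, f t) * (T + 1) ^ (1 + η / 2) :=
          mul_le_mul (by linarith [le_abs_self C])
            (Real.rpow_le_rpow hT (by linarith) (by linarith)) (by positivity) (by positivity)
  have hpos := integrableOn_mul_rpow_of_primitive_le hfc hf0 (p := 1 + η) (by linarith)
    (by linarith) hbound
  have hpos' : MeasureTheory.IntegrableOn (fun t => f t * (|t| + 1) ^ (-(1 + η))) (Set.Ioi 0) :=
    hpos.congr_fun (fun t ht => by simp only [abs_of_pos (Set.mem_Ioi.1 ht)]) measurableSet_Ioi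
  have hneg : MeasureTheory.IntegrableOn (fun t => f t * (|t| + 1) ^ (-(1 + η))) (Set.Iio 0) := by
    have h3 := (MeasureTheory.Measure.measurePreserving_neg
      (MeasureTheory.volume : MeasureTheory.Measure ℝ)).integrableOn_comp_preimage
      (Homeomorph.neg ℝ).measurableEmbedding (s := Set.Ioi 0) |>.2 hpos'
    have h4 : (Neg.neg : ℝ → ℝ) ⁻¹' Set.Ioi 0 = Set.Iio 0 := by ext; simp
    rw [h4] at h3
    refine h3.congr_fun (fun t _ => ?_) measurableSet_Iio
    simp only [hf, Function.comp, abs_neg, norm_riemannZeta_vertical_neg]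
  rw [← MeasureTheory.integrableOn_univ, ← Set.Iio_union_Ici (a := (0 : ℝ))]
  exact hneg.union (Iff.mpr integrableOn_Ici_iff_integrableOn_Ioi hpos')

/-! ### Mean square of the remainder under multiplicative shifts -/

theorem norm_sum_div_pow_le {k : ℕ} (a : ℕ → ℂ) {z : ℂ} (hz : 1 ≤ ‖z‖) :
    ‖∑ j ∈ Finset.range k, a j / z ^ (j + 1)‖ ≤ ∑ j ∈ Finset.range k, ‖a j‖ := by
  refine (norm_sum_le _ _).trans (Finset.sum_le_sum fun j _ => ?_)
  rw [norm_div, norm_pow]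
  exact div_le_self (norm_nonneg _) (one_le_pow₀ hz)

/-- Compactness covers `|y| ≤ 1`, where `H` has no pole; above that height the principal part is
bounded and the growth of zeta decides. -/
theorem exists_norm_regular_part_le_exp {k : ℕ} {a : ℕ → ℂ} {H : ℂ → ℂ}
    (hH : DifferentiableOn ℂ H {s | 0 < s.re})
    (h : ∀ s : ℂ, 0 < s.re → s ≠ 1 → riemannZeta s ^ k / s =
        ∑ j ∈ Finset.range k, a j / (s - 1) ^ (j + 1) + H s) {σ : ℝ} (hσ : 1 / 2 ≤ σ) (c : ℝ) :
    ∃ B : ℝ, ∀ x ∈ Set.Icc σ c, ∀ y : ℝ,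
      ‖H (x + y * Complex.I)‖ ≤ B * Real.exp (2 * k * |y|) := by
  obtain ⟨C, hC⟩ := norm_riemannZeta_le_of_one_half_le_re
  have hcomp : IsCompact (Set.Icc σ c ×ℂ Set.Icc (-1 : ℝ) 1) := isCompact_Icc.reProdIm isCompact_Icc
  have hcont : ContinuousOn H (Set.Icc σ c ×ℂ Set.Icc (-1 : ℝ) 1) :=
    hH.continuousOn.mono fun s hs => by
      have := (Complex.mem_reProdIm.1 hs).1.1
      change 0 < s.re
      linarith
  obtain ⟨B₀, hB₀⟩ := hcomp.exists_bound_of_continuousOn hcont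
  have hA : 0 ≤ ∑ j ∈ Finset.range k, ‖a j‖ := Finset.sum_nonneg fun _ _ => norm_nonneg _
  refine ⟨|B₀| + (|C| ^ k + ∑ j ∈ Finset.range k, ‖a j‖), fun x hx y => ?_⟩
  set s : ℂ := x + y * Complex.I with hs
  have hre : s.re = x := by simp [hs]
  have him : s.im = y := by simp [hs]
  have hexp : 1 ≤ Real.exp (2 * k * |y|) := Real.one_le_exp (by positivity)
  rcases le_total |y| 1 with hy | hy
  · have h1 : ‖H s‖ ≤ |B₀| := (hB₀ s (Complex.mem_reProdIm.2
      ⟨by rwa [hre], by rw [him]; exact abs_le.1 hy⟩)).trans (le_abs_self _)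
    have h2 : 0 ≤ |C| ^ k + ∑ j ∈ Finset.range k, ‖a j‖ := by positivity
    calc ‖H s‖ ≤ (|B₀| + (|C| ^ k + ∑ j ∈ Finset.range k, ‖a j‖)) * 1 := by linarith
      _ ≤ _ := mul_le_mul_of_nonneg_left hexp (by positivity)
  · have hs1 : s ≠ 1 := by
      intro h1
      rw [h1] at him
      simp at him
      rw [← him] at hy
      simp at hy
      linarith
    have hn : 1 ≤ ‖s‖ := hy.trans (by simpa [him] using Complex.abs_im_le_norm s)
    have hn' : 1 ≤ ‖s - 1‖ := hy.trans (by simpa [him] using Complex.abs_im_le_norm (s - 1))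
    have hz : ‖riemannZeta s‖ ≤ |C| * Real.exp (2 * |y|) := by
      have := hC s (by rw [hre]; linarith [hx.1]) (by rwa [him])
      rw [him] at this
      exact this.trans (mul_le_mul_of_nonneg_right (le_abs_self C) (Real.exp_pos _).le)
    have hz' : ‖riemannZeta s ^ k / s‖ ≤ |C| ^ k * Real.exp (2 * k * |y|) := by
      rw [norm_div, norm_pow]
      calc ‖riemannZeta s‖ ^ k / ‖s‖ ≤ ‖riemannZeta s‖ ^ k := div_le_self (by positivity) hn
        _ ≤ (|C| * Real.exp (2 * |y|)) ^ k := pow_le_pow_left₀ (norm_nonneg _) hz k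
        _ = _ := by rw [mul_pow, ← Real.exp_nat_mul]; ring_nf
    have hHs : H s = riemannZeta s ^ k / s - ∑ j ∈ Finset.range k, a j / (s - 1) ^ (j + 1) := by
      rw [h s (by rw [hre]; linarith [hx.1]) hs1]
      ring
    rw [hHs]
    calc _ ≤ |C| ^ k * Real.exp (2 * k * |y|) + ∑ j ∈ Finset.range k, ‖a j‖ :=
          (norm_sub_le _ _).trans (add_le_add hz' (norm_sum_div_pow_le a hn'))
      _ ≤ |C| ^ k * Real.exp (2 * k * |y|) +
          (∑ j ∈ Finset.range k, ‖a j‖) * Real.exp (2 * k * |y|) :=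
          add_le_add_right (le_mul_of_one_le_right hA hexp) _
      _ ≤ _ := by
          rw [add_mul, add_mul]
          have : 0 ≤ |B₀| * Real.exp (2 * k * |y|) := by positivity
          linarith

/-- Since `σ < 1`, the line stays at distance `1 - σ` from the pole, so `s` times the principal part
is bounded on it. Then `(p + M)² ≤ 2p² + 2M²`. -/
theorem exists_norm_regular_part_sq_le {k : ℕ} {a : ℕ → ℂ} {H : ℂ → ℂ}
    (h : ∀ s : ℂ, 0 < s.re → s ≠ 1 → riemannZeta s ^ k / s =
        ∑ j ∈ Finset.range k, a j / (s - 1) ^ (j + 1) + H s) {σ : ℝ} (hσ : 1 / 2 ≤ σ)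
    (hσ1 : σ < 1) :
    ∃ B : ℝ, 0 ≤ B ∧ ∀ y : ℝ, ‖H (σ + y * Complex.I)‖ ^ 2 * ‖(σ : ℂ) + y * Complex.I‖ ^ 2 ≤
      2 * ‖riemannZeta (σ + y * Complex.I)‖ ^ (2 * k) + B := by
  have hd : 0 < 1 - σ := by linarith
  set M := ∑ j ∈ Finset.range k, ‖a j‖ * ((1 - σ)⁻¹ ^ j * (1 + (1 - σ)⁻¹)) with hM
  refine ⟨2 * M ^ 2, by positivity, fun y => ?_⟩
  set s : ℂ := σ + y * Complex.I with hs
  have hre : s.re = σ := by simp [hs]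
  have hs0 : s ≠ 0 := by
    intro h0
    rw [h0, Complex.zero_re] at hre
    linarith
  have hs1 : s ≠ 1 := by
    intro h1
    rw [h1, Complex.one_re] at hre
    linarith
  have hn : 1 - σ ≤ ‖s - 1‖ := by
    have := Complex.abs_re_le_norm (s - 1)
    rw [Complex.sub_re, hre, Complex.one_re, abs_sub_comm, abs_of_pos hd] at this
    exact this
  have hn0 : 0 < ‖s - 1‖ := hd.trans_le hn
  have hinv : ‖s - 1‖⁻¹ ≤ (1 - σ)⁻¹ := inv_anti₀ hd hn
  have hsn : ‖s‖ * ‖s - 1‖⁻¹ ≤ 1 + (1 - σ)⁻¹ := by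
    have h1 : ‖s‖ ≤ ‖s - 1‖ + 1 := by
      simpa using norm_add_le (s - 1) 1
    calc ‖s‖ * ‖s - 1‖⁻¹ ≤ (‖s - 1‖ + 1) * ‖s - 1‖⁻¹ :=
          mul_le_mul_of_nonneg_right h1 (by positivity)
      _ = 1 + ‖s - 1‖⁻¹ := by field_simp
      _ ≤ _ := by linarith
  have hP : ‖(∑ j ∈ Finset.range k, a j / (s - 1) ^ (j + 1)) * s‖ ≤ M := by
    rw [Finset.sum_mul]
    refine (norm_sum_le _ _).trans (Finset.sum_le_sum fun j _ => ?_)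
    rw [norm_mul, norm_div, norm_pow]
    calc ‖a j‖ / ‖s - 1‖ ^ (j + 1) * ‖s‖ = ‖a j‖ * (‖s - 1‖⁻¹ ^ j * (‖s‖ * ‖s - 1‖⁻¹)) := by
          rw [div_eq_mul_inv, ← inv_pow, pow_succ]; ring
      _ ≤ _ := by
          refine mul_le_mul_of_nonneg_left (mul_le_mul ?_ hsn (by positivity) (by positivity))
            (norm_nonneg _)
          exact pow_le_pow_left₀ (by positivity) hinv j
  have hHs : H s * s =
      riemannZeta s ^ k - (∑ j ∈ Finset.range k, a j / (s - 1) ^ (j + 1)) * s := by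
    have := h s (by rw [hre]; linarith) hs1
    rw [div_eq_iff hs0] at this
    rw [this]
    ring
  rw [← mul_pow, ← norm_mul, hHs]
  have h3 := norm_sub_le (riemannZeta s ^ k)
    ((∑ j ∈ Finset.range k, a j / (s - 1) ^ (j + 1)) * s)
  have h4 : ‖riemannZeta s‖ ^ (2 * k) = ‖riemannZeta s ^ k‖ ^ 2 := by
    rw [norm_pow, ← pow_mul, mul_comm]
  rw [h4]
  have h5 := pow_le_pow_left₀ (norm_nonneg _) (h3.trans (add_le_add_right hP _)) 2
  nlinarith [sq_nonneg (‖riemannZeta s ^ k‖ - M)]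

/-- Interpolates between `|e^z - 1| ≤ 2|z|` for small `z` and boundedness for large `z`. With `z =
bs`, the exponent `1 - η` leaves the weight `|s|^{-2}|s|^{1-η} = |s|^{-1-η}`, just enough for the
moment integral to converge. -/
theorem norm_cexp_sub_one_sq_le {z : ℂ} (h0 : 0 ≤ z.re) (h2 : z.re ≤ 2) {η : ℝ} (hη : 0 < η)
    (hη1 : η < 1) : ‖Complex.exp z - 1‖ ^ 2 ≤ 100 * ‖z‖ ^ (1 - η) := by
  rcases le_total ‖z‖ 1 with h | h
  · rcases eq_or_ne z 0 with rfl | hz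
    · simp
      positivity
    have h1 := Complex.norm_exp_sub_one_le h
    have h3 : ‖z‖ ^ (2 : ℝ) ≤ ‖z‖ ^ (1 - η) :=
      Real.rpow_le_rpow_of_exponent_ge (norm_pos_iff.2 hz) h (by linarith)
    rw [Real.rpow_two] at h3
    calc ‖Complex.exp z - 1‖ ^ 2 ≤ (2 * ‖z‖) ^ 2 := pow_le_pow_left₀ (norm_nonneg _) h1 2
      _ = 4 * ‖z‖ ^ 2 := by ring
      _ ≤ 4 * ‖z‖ ^ (1 - η) := by linarith
      _ ≤ _ := by
        have : 0 ≤ ‖z‖ ^ (1 - η) := by positivity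
        linarith
  · have h3 : 1 ≤ ‖z‖ ^ (1 - η) := Real.one_le_rpow h (by linarith)
    have h4 : ‖Complex.exp z - 1‖ ≤ 10 := by
      have h5 := norm_sub_le (Complex.exp z) 1
      rw [norm_one, Complex.norm_exp] at h5
      have h6 : Real.exp z.re ≤ 9 := by
        calc Real.exp z.re ≤ Real.exp 2 := Real.exp_le_exp.2 h2
          _ = Real.exp 1 ^ 2 := by rw [← Real.exp_nat_mul]; norm_num
          _ ≤ 3 ^ 2 := pow_le_pow_left₀ (Real.exp_pos 1).le Real.exp_one_lt_three.le 2
          _ = 9 := by norm_num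
      linarith
    calc ‖Complex.exp z - 1‖ ^ 2 ≤ 10 ^ 2 := pow_le_pow_left₀ (norm_nonneg _) h4 2
      _ ≤ _ := by linarith

theorem IsAdmissibleSigma.exists_lintegral_regular_part_le {k : ℕ} {σ : ℝ}
    (hadm : IsAdmissibleSigma k σ) {a : ℕ → ℂ} {H : ℂ → ℂ}
    (h : ∀ s : ℂ, 0 < s.re → s ≠ 1 → riemannZeta s ^ k / s =
        ∑ j ∈ Finset.range k, a j / (s - 1) ^ (j + 1) + H s)
    {η : ℝ} (hη : 0 < η) (hη1 : η < 1) :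
    ∃ C : ℝ, 0 ≤ C ∧ ∀ b : ℝ, 0 ≤ b → b ≤ 2 → ∫⁻ y : ℝ, ENNReal.ofReal
      (‖H (σ + y * Complex.I) * (Complex.exp (b * (σ + y * Complex.I)) - 1)‖ ^ 2) ≤
        ENNReal.ofReal (C * b ^ (1 - η)) := by
  obtain ⟨B, hB0, hB⟩ := exists_norm_regular_part_sq_le h hadm.1 hadm.2.1
  have hi1 := hadm.integrable_weighted_moment hη
  have hi2 : MeasureTheory.Integrable fun t : ℝ => (|t| + 1) ^ (-(1 + η)) := by
    have := integrable_one_add_norm (μ := (MeasureTheory.volume : MeasureTheory.Measure ℝ))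
      (r := 1 + η) (by simp; linarith)
    refine this.congr (Eventually.of_forall fun t => ?_)
    simp only [Real.norm_eq_abs, add_comm]
  -- The constant is `100 · 9`: `100` from `norm_cexp_sub_one_sq_le`, and `9 ≥ 3^{1+η}` from `|s| ≥
  -- (|y|+1)/3`, valid as `σ ≥ 1/2`.
  have hi := ((hi1.const_mul 2).add (hi2.const_mul B)).const_mul 900
  set W : ℝ → ℝ := fun t => 900 * (2 * (‖riemannZeta (σ + t * Complex.I)‖ ^ (2 * k) *
    (|t| + 1) ^ (-(1 + η))) + B * (|t| + 1) ^ (-(1 + η))) with hW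
  have hW0 : ∀ t, 0 ≤ W t := fun t => by positivity
  refine ⟨∫ t, W t, MeasureTheory.integral_nonneg hW0, fun b hb0 hb2 => ?_⟩
  have hpt : ∀ y : ℝ,
      ‖H (σ + y * Complex.I) * (Complex.exp (b * (σ + y * Complex.I)) - 1)‖ ^ 2 ≤
        W y * b ^ (1 - η) := by
    intro y
    set s : ℂ := σ + y * Complex.I with hs
    have hre : s.re = σ := by simp [hs]
    have him : s.im = y := by simp [hs]
    have hsn : (|y| + 1) / 3 ≤ ‖s‖ := by
      have h1 := Complex.abs_im_le_norm s
      have h2 := (le_abs_self _).trans (Complex.abs_re_le_norm s)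
      rw [him] at h1
      rw [hre] at h2
      linarith [hadm.1]
    have hy0 : 0 < |y| + 1 := by positivity
    have hs0 : 0 < ‖s‖ := lt_of_lt_of_le (by positivity) hsn
    have hzre : ((b : ℂ) * s).re = b * σ := by rw [Complex.re_ofReal_mul, hre]
    have h1 := norm_cexp_sub_one_sq_le (z := b * s)
      (by rw [hzre]; exact mul_nonneg hb0 (by linarith [hadm.1]))
      (by rw [hzre]; nlinarith [hadm.1, hadm.2.1]) hη hη1
    rw [norm_mul (b : ℂ), Complex.norm_real, Real.norm_of_nonneg hb0,
      Real.mul_rpow hb0 hs0.le] at h1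
    have h2 : ‖s‖ ^ (-(1 + η)) ≤ 9 * (|y| + 1) ^ (-(1 + η)) := by
      calc ‖s‖ ^ (-(1 + η)) ≤ ((|y| + 1) / 3) ^ (-(1 + η)) :=
            Real.rpow_le_rpow_of_nonpos (by positivity) hsn (by linarith)
        _ = (|y| + 1) ^ (-(1 + η)) * 3 ^ (1 + η) := by
            rw [Real.div_rpow hy0.le (by norm_num), Real.rpow_neg (by norm_num : (0 : ℝ) ≤ 3),
              div_inv_eq_mul]
        _ ≤ (|y| + 1) ^ (-(1 + η)) * 3 ^ (2 : ℝ) := by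
            refine mul_le_mul_of_nonneg_left ?_ (by positivity)
            exact Real.rpow_le_rpow_of_exponent_le (by norm_num) (by linarith)
        _ = _ := by rw [Real.rpow_two]; ring
    have h3 : ‖s‖ ^ (1 - η) = ‖s‖ ^ 2 * ‖s‖ ^ (-(1 + η)) := by
      rw [← Real.rpow_two, ← Real.rpow_add hs0]
      ring_nf
    have h4 := hB y
    rw [norm_mul, mul_pow]
    calc ‖H s‖ ^ 2 * ‖Complex.exp (b * s) - 1‖ ^ 2
        ≤ ‖H s‖ ^ 2 * (100 * (b ^ (1 - η) * ‖s‖ ^ (1 - η))) :=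
          mul_le_mul_of_nonneg_left h1 (by positivity)
      _ = 100 * b ^ (1 - η) * ((‖H s‖ ^ 2 * ‖s‖ ^ 2) * ‖s‖ ^ (-(1 + η))) := by rw [h3]; ring
      _ ≤ 100 * b ^ (1 - η) * ((2 * ‖riemannZeta s‖ ^ (2 * k) + B) *
          (9 * (|y| + 1) ^ (-(1 + η)))) :=
          mul_le_mul_of_nonneg_left (mul_le_mul h4 h2 (by positivity) (by positivity))
            (by positivity)
      _ = W y * b ^ (1 - η) := by simp only [hW]; ring
  calc _ ≤ ∫⁻ y : ℝ, ENNReal.ofReal (W y * b ^ (1 - η)) :=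
        MeasureTheory.lintegral_mono fun y => ENNReal.ofReal_le_ofReal (hpt y)
    _ = ENNReal.ofReal (∫ y, W y * b ^ (1 - η)) :=
        (MeasureTheory.ofReal_integral_eq_lintegral_ofReal (hi.mul_const _)
          (Eventually.of_forall fun y => mul_nonneg (hW0 y) (by positivity))).symm
    _ = _ := by rw [MeasureTheory.integral_mul_const]

theorem IsAdmissibleSigma.exists_lintegral_divisorRemainder_shift_le {k : ℕ} {σ : ℝ}
    (hadm : IsAdmissibleSigma k σ) {a : ℕ → ℂ} {H : ℂ → ℂ}
    (hH : DifferentiableOn ℂ H {s | 0 < s.re})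
    (h : ∀ s : ℂ, 0 < s.re → s ≠ 1 → riemannZeta s ^ k / s =
        ∑ j ∈ Finset.range k, a j / (s - 1) ^ (j + 1) + H s)
    {η : ℝ} (hη : 0 < η) (hη1 : η < 1) :
    ∃ C : ℝ, 0 ≤ C ∧ ∀ b : ℝ, 0 ≤ b → b ≤ 2 → ∫⁻ u : ℝ, ENNReal.ofReal
      (‖divisorRemainder k a (u + b) - divisorRemainder k a u‖ ^ 2 * Real.exp (-2 * σ * u)) ≤
        ENNReal.ofReal (C * b ^ (1 - η)) := by
  obtain ⟨C, hC0, hC⟩ := hadm.exists_lintegral_regular_part_le h hη hη1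
  refine ⟨2 * Real.pi * Real.exp (2 * σ ^ 2) * C, by positivity, fun b hb0 hb2 => ?_⟩
  have hk0 : (0 : ℝ) ≤ k := by positivity
  -- Any abscissa beyond `k + 2` would serve, that being the growth exponent of the remainder.
  set c : ℝ := k + 3
  have hσ := hadm.1
  have hσ1 := hadm.2.1
  obtain ⟨B, hB⟩ := exists_norm_regular_part_le_exp hH h hσ c
  obtain ⟨D, hD⟩ := exists_norm_divisorRemainder_le k a
  have hD0 : 0 ≤ D := by
    have := (norm_nonneg _).trans (hD 0)
    simpa using this
  have hmeas := measurable_divisorRemainder k a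
  have hle : ∀ w, ‖divisorRemainder k a w‖ ≤ D * Real.exp ((k + 2) * |w|) := fun w =>
    (hD w).trans (mul_le_mul_of_nonneg_left (Real.exp_le_exp.2
      (mul_le_mul_of_nonneg_left (le_abs_self w) (by positivity))) hD0)
  have hEi : MeasureTheory.Integrable fun w : ℝ =>
      divisorRemainder k a w * Complex.exp (-c * w) := by
    have h1 := integrableOn_Ioi_of_norm_le_exp hmeas (fun w _ => hD w) (s := c)
      (by simp [c]; norm_num)
    have h2 := Iff.mpr integrableOn_Ici_iff_integrableOn_Ioi h1
    refine (MeasureTheory.integrableOn_iff_integrable_of_support_subset fun w hw => ?_).1 h2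
    by_contra hneg
    refine hw ?_
    have hneg' : w < 0 := lt_of_not_ge fun h0 => hneg h0
    simp only [divisorRemainder, if_pos hneg', zero_mul]
  refine (lintegral_sq_norm_shift_sub_le (σ := σ) (c := c) (H := H) (by simp [c]; linarith) hmeas
    (by positivity) hle (ae_continuousAt_divisorRemainder k a) hEi (fun y => ?_)
    (hH.mono fun s hs => ?_) hB b).trans ?_
  · exact integral_divisorRemainder_mul_cexp h (by simp [c]; norm_num)
  · have := (Complex.mem_reProdIm.1 hs).1.1
    change 0 < s.re
    linarith
  · rw [mul_assoc _ C, ENNReal.ofReal_mul (p := 2 * Real.pi * Real.exp (2 * σ ^ 2)) (by positivity)]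
    exact mul_le_mul_right (hC b hb0 hb2) _

/-! ### From multiplicative to additive shifts -/

theorem setLIntegral_Icc_comp_add_right (g : ℝ → ENNReal) (p q h : ℝ) :
    ∫⁻ x in Set.Icc p q, g (x + h) = ∫⁻ x in Set.Icc (p + h) (q + h), g x := by
  have := (MeasureTheory.measurePreserving_add_right
    (MeasureTheory.volume : MeasureTheory.Measure ℝ) h).setLIntegral_comp_preimage_emb
    (Homeomorph.addRight h).measurableEmbedding g (Set.Icc (p + h) (q + h))
  rw [← this]
  simp

theorem lintegral_comp_exp (g : ℝ → ENNReal) :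
    ∫⁻ x in Set.Ioi (0 : ℝ), g x = ∫⁻ u : ℝ, ENNReal.ofReal (Real.exp u) * g (Real.exp u) := by
  have himg : Real.exp '' Set.univ = Set.Ioi 0 := by rw [Set.image_univ, Real.range_exp]
  rw [← himg, MeasureTheory.lintegral_image_eq_lintegral_abs_deriv_mul MeasurableSet.univ
    (fun x _ => (Real.hasDerivAt_exp x).hasDerivWithinAt) Real.exp_injective.injOn,
    MeasureTheory.Measure.restrict_univ]
  simp only [abs_of_pos (Real.exp_pos _)]

theorem ofReal_norm_sub_sq_le (x y z : ℂ) :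
    ENNReal.ofReal (‖y - x‖ ^ 2) ≤
      2 * ENNReal.ofReal (‖z - x‖ ^ 2) + 2 * ENNReal.ofReal (‖z - y‖ ^ 2) := by
  rw [← ENNReal.ofReal_ofNat 2, ← ENNReal.ofReal_mul zero_le_two, ← ENNReal.ofReal_mul zero_le_two,
    ← ENNReal.ofReal_add (by positivity) (by positivity)]
  refine ENNReal.ofReal_le_ofReal ?_
  have h1 : ‖y - x‖ ≤ ‖z - x‖ + ‖z - y‖ := by
    rw [show y - x = (z - x) - (z - y) by ring]
    exact norm_sub_le _ _
  have h2 := pow_le_pow_left₀ (norm_nonneg _) h1 2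
  nlinarith [sq_nonneg (‖z - x‖ - ‖z - y‖)]

theorem measurable_ofReal_norm_shift_sub_sq {f : ℝ → ℂ} (hf : Measurable f) :
    Measurable fun p : ℝ × ℝ => ENNReal.ofReal (‖f (p.2 + p.1) - f p.2‖ ^ 2) := by
  have : Measurable fun p : ℝ × ℝ => f (p.2 + p.1) := hf.comp (by fun_prop)
  have : Measurable fun p : ℝ × ℝ => f p.2 := hf.comp (by fun_prop)
  fun_prop

/-- Compare `f(x)` and `f(x+h)` through the common point `x + v`, which lies at distance `v - h`
from `x + h`. Recentring at `x + h` keeps the range inside `[X, 3X]` because `h ≤ X`. -/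
theorem lintegral_shift_le_add {f : ℝ → ℂ} (hf : Measurable f) {X h : ℝ} (hh : 0 < h)
    (hhX : h ≤ X) (v : ℝ) :
    ∫⁻ x in Set.Icc X (2 * X), ENNReal.ofReal (‖f (x + h) - f x‖ ^ 2) ≤
      2 * (∫⁻ x in Set.Icc X (3 * X), ENNReal.ofReal (‖f (x + v) - f x‖ ^ 2)) +
      2 * ∫⁻ x in Set.Icc X (3 * X), ENNReal.ofReal (‖f (x + (v + -h)) - f x‖ ^ 2) := by
  have hmv : Measurable fun x : ℝ => ENNReal.ofReal (‖f (x + v) - f x‖ ^ 2) := by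
    have := hf.comp (measurable_add_const v)
    exact (((this.sub hf).norm).pow_const 2).ennreal_ofReal
  calc ∫⁻ x in Set.Icc X (2 * X), ENNReal.ofReal (‖f (x + h) - f x‖ ^ 2)
      ≤ ∫⁻ x in Set.Icc X (2 * X), (2 * ENNReal.ofReal (‖f (x + v) - f x‖ ^ 2) +
          2 * ENNReal.ofReal (‖f (x + h + (v + -h)) - f (x + h)‖ ^ 2)) := by
        refine MeasureTheory.lintegral_mono fun x => ?_
        rw [show x + h + (v + -h) = x + v by ring]
        exact ofReal_norm_sub_sq_le _ _ _
    _ = 2 * (∫⁻ x in Set.Icc X (2 * X), ENNReal.ofReal (‖f (x + v) - f x‖ ^ 2)) +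
        2 * ∫⁻ x in Set.Icc X (2 * X),
          ENNReal.ofReal (‖f (x + h + (v + -h)) - f (x + h)‖ ^ 2) := by
        rw [MeasureTheory.lintegral_add_left (hmv.const_mul 2),
          MeasureTheory.lintegral_const_mul' _ _ (by simp),
          MeasureTheory.lintegral_const_mul' _ _ (by simp)]
    _ ≤ _ := by
        rw [setLIntegral_Icc_comp_add_right
          (fun y => ENNReal.ofReal (‖f (y + (v + -h)) - f y‖ ^ 2))]
        refine add_le_add (mul_le_mul_right (MeasureTheory.lintegral_mono_set ?_) _)
          (mul_le_mul_right (MeasureTheory.lintegral_mono_set ?_) _)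
        · exact Set.Icc_subset_Icc le_rfl (by linarith)
        · exact Set.Icc_subset_Icc (by linarith) (by linarith)

/-- For `v ∈ [2h, 3h]` both `v` and `v - h` lie in `[0, 3h]`, so integrating over `v` yields `2 + 2`
copies of one integral. -/
theorem ofReal_mul_le_lintegral_of_forall_le_add {B : ℝ → ENNReal} (hB : Measurable B) {h : ℝ}
    (hh : 0 < h) {c : ENNReal} (hc : ∀ v ∈ Set.Icc (2 * h) (3 * h), c ≤ 2 * B v + 2 * B (v + -h)) :
    ENNReal.ofReal h * c ≤ 4 * ∫⁻ v in Set.Icc 0 (3 * h), B v := by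
  have hint : ∫⁻ _v in Set.Icc (2 * h) (3 * h), c ≤
      ∫⁻ v in Set.Icc (2 * h) (3 * h), (2 * B v + 2 * B (v + -h)) :=
    MeasureTheory.setLIntegral_mono' measurableSet_Icc hc
  rw [MeasureTheory.setLIntegral_const, Real.volume_Icc, mul_comm,
    show 3 * h - 2 * h = h by ring, MeasureTheory.lintegral_add_left (hB.const_mul 2),
    MeasureTheory.lintegral_const_mul' _ _ (by simp),
    MeasureTheory.lintegral_const_mul' _ _ (by simp), setLIntegral_Icc_comp_add_right B] at hint
  refine hint.trans ?_
  have h1 : ∫⁻ v in Set.Icc (2 * h) (3 * h), B v ≤ ∫⁻ v in Set.Icc 0 (3 * h), B v :=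
    MeasureTheory.lintegral_mono_set (Set.Icc_subset_Icc (by linarith) le_rfl)
  have h2 : ∫⁻ v in Set.Icc (2 * h + -h) (3 * h + -h), B v ≤ ∫⁻ v in Set.Icc 0 (3 * h), B v :=
    MeasureTheory.lintegral_mono_set (Set.Icc_subset_Icc (by linarith) (by linarith))
  refine (add_le_add (mul_le_mul_right h1 2) (mul_le_mul_right h2 2)).trans_eq ?_
  rw [← add_mul]
  norm_num

/-- Averaging over an auxiliary shift `v ∈ [2h, 3h]`. -/
theorem lintegral_shift_le_average {f : ℝ → ℂ} (hf : Measurable f) {X h : ℝ} (hh : 0 < h)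
    (hhX : h ≤ X) :
    ENNReal.ofReal h * ∫⁻ x in Set.Icc X (2 * X), ENNReal.ofReal (‖f (x + h) - f x‖ ^ 2) ≤
      4 * ∫⁻ v in Set.Icc 0 (3 * h), ∫⁻ x in Set.Icc X (3 * X),
        ENNReal.ofReal (‖f (x + v) - f x‖ ^ 2) :=
  ofReal_mul_le_lintegral_of_forall_le_add
    (measurable_ofReal_norm_shift_sub_sq hf).lintegral_prod_right' hh
    fun v _ => lintegral_shift_le_add hf hh hhX v

/-- Additive shifts of length at most `3h` are dominated by multiplicative shifts of ratio at most
`1 + 3h/X`. -/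
theorem lintegral_additive_le_multiplicative {f : ℝ → ℂ} (hf : Measurable f) {X h : ℝ}
    (hX : 0 < X) (hh : 0 < h) :
    ∫⁻ v in Set.Icc 0 (3 * h), ∫⁻ x in Set.Icc X (3 * X),
        ENNReal.ofReal (‖f (x + v) - f x‖ ^ 2) ≤
      ENNReal.ofReal (3 * X) * ∫⁻ δ in Set.Icc 0 (3 * h / X), ∫⁻ x in Set.Icc X (3 * X),
        ENNReal.ofReal (‖f (x + x * δ) - f x‖ ^ 2) := by
  have hm1 := measurable_ofReal_norm_shift_sub_sq hf
  have hm2 : Measurable fun p : ℝ × ℝ => ENNReal.ofReal (‖f (p.2 + p.2 * p.1) - f p.2‖ ^ 2) := by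
    have : Measurable fun p : ℝ × ℝ => f (p.2 + p.2 * p.1) := hf.comp (by fun_prop)
    have : Measurable fun p : ℝ × ℝ => f p.2 := hf.comp (by fun_prop)
    fun_prop
  rw [MeasureTheory.lintegral_lintegral_swap hm1.aemeasurable,
    MeasureTheory.lintegral_lintegral_swap
      (f := fun δ x => ENNReal.ofReal (‖f (x + x * δ) - f x‖ ^ 2)) hm2.aemeasurable,
    ← MeasureTheory.lintegral_const_mul' _ _ ENNReal.ofReal_ne_top]
  refine MeasureTheory.setLIntegral_mono' measurableSet_Icc fun x hx => ?_
  have hx0 : 0 < x := hX.trans_le hx.1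
  -- With `x` fixed, substitute `v = xδ`: `x ≥ X` bounds the range of `δ`, and the Jacobian `x ≤ 3X`
  -- gives the factor in front.
  have hsub : Set.Icc 0 (3 * h) ⊆ (fun δ => x * δ) '' Set.Icc 0 (3 * h / X) := by
    intro v hv
    refine ⟨v / x, ⟨div_nonneg hv.1 hx0.le, ?_⟩, mul_div_cancel₀ _ hx0.ne'⟩
    exact div_le_div₀ (by linarith) hv.2 hX hx.1
  refine (MeasureTheory.lintegral_mono_set hsub).trans ?_
  rw [MeasureTheory.lintegral_image_eq_lintegral_abs_deriv_mul measurableSet_Icc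
    (f' := fun _ => x * 1) (fun δ _ => ((hasDerivAt_id' δ).const_mul x).hasDerivWithinAt)
    (mul_right_injective₀ hx0.ne').injOn,
    ← MeasureTheory.lintegral_const_mul' _ _ ENNReal.ofReal_ne_top]
  refine MeasureTheory.lintegral_mono fun δ => mul_le_mul_left ?_ _
  rw [mul_one, abs_of_pos hx0]
  exact ENNReal.ofReal_le_ofReal hx.2

/-- Put `x = e^u`: the ratio `1 + δ` becomes the shift `b = log(1 + δ) ≤ δ`, and `dx = e^u du` turns
`e^{-2σu} du` into `x^{-(2σ+1)} dx`. The cap `δ ≤ 3` ensures `b ≤ log 4 < 2`. -/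
theorem lintegral_multiplicative_shift_le {E : ℝ → ℂ} {σ C κ : ℝ} (hσ : 0 ≤ σ) (hκ : 0 ≤ κ)
    (hC : 0 ≤ C)
    (hE : ∀ b : ℝ, 0 ≤ b → b ≤ 2 → ∫⁻ u : ℝ, ENNReal.ofReal
      (‖E (u + b) - E u‖ ^ 2 * Real.exp (-2 * σ * u)) ≤ ENNReal.ofReal (C * b ^ κ))
    {X Y δ : ℝ} (hX : 0 < X) (hXY : X ≤ Y) (hδ : 0 ≤ δ) (hδ3 : δ ≤ 3) :
    ∫⁻ x in Set.Icc X Y, ENNReal.ofReal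
      (‖E (Real.log (x + x * δ)) - E (Real.log x)‖ ^ 2) ≤
      ENNReal.ofReal (Y ^ (2 * σ + 1) * (C * δ ^ κ)) := by
  have hY : 0 < Y := hX.trans_le hXY
  set b := Real.log (1 + δ) with hb
  have hb0 : 0 ≤ b := Real.log_nonneg (by linarith)
  have hbδ : b ≤ δ := by
    have := Real.log_le_sub_one_of_pos (x := 1 + δ) (by linarith)
    linarith
  have hb2 : b ≤ 2 := by
    have h1 : b ≤ Real.log (2 ^ 2) := Real.log_le_log (by linarith) (by linarith)
    rw [Real.log_pow] at h1
    have := Real.log_two_lt_d9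
    push_cast at h1
    linarith
  have hpt : ∀ x ∈ Set.Icc X Y, ENNReal.ofReal
      (‖E (Real.log (x + x * δ)) - E (Real.log x)‖ ^ 2) ≤ ENNReal.ofReal (Y ^ (2 * σ + 1)) *
      ENNReal.ofReal (‖E (Real.log x + b) - E (Real.log x)‖ ^ 2 * x ^ (-(2 * σ + 1))) := by
    intro x hx
    have hx0 : 0 < x := hX.trans_le hx.1
    rw [← ENNReal.ofReal_mul (by positivity)]
    refine ENNReal.ofReal_le_ofReal ?_
    have e1 : Real.log (x + x * δ) = Real.log x + b := by
      rw [hb, ← Real.log_mul hx0.ne' (by linarith)]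
      ring_nf
    rw [e1]
    have h1 : 1 ≤ Y ^ (2 * σ + 1) * x ^ (-(2 * σ + 1)) := by
      rw [Real.rpow_neg hx0.le, ← div_eq_mul_inv, one_le_div (by positivity)]
      exact Real.rpow_le_rpow hx0.le hx.2 (by linarith)
    calc _ ≤ (Y ^ (2 * σ + 1) * x ^ (-(2 * σ + 1))) *
          ‖E (Real.log x + b) - E (Real.log x)‖ ^ 2 := le_mul_of_one_le_left (by positivity) h1
      _ = _ := by ring
  calc _ ≤ ∫⁻ x in Set.Icc X Y, ENNReal.ofReal (Y ^ (2 * σ + 1)) *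
        ENNReal.ofReal (‖E (Real.log x + b) - E (Real.log x)‖ ^ 2 * x ^ (-(2 * σ + 1))) :=
        MeasureTheory.setLIntegral_mono' measurableSet_Icc hpt
    _ = ENNReal.ofReal (Y ^ (2 * σ + 1)) * ∫⁻ x in Set.Icc X Y,
        ENNReal.ofReal (‖E (Real.log x + b) - E (Real.log x)‖ ^ 2 * x ^ (-(2 * σ + 1))) :=
        MeasureTheory.lintegral_const_mul' _ _ ENNReal.ofReal_ne_top
    _ ≤ ENNReal.ofReal (Y ^ (2 * σ + 1)) * ∫⁻ x in Set.Ioi (0 : ℝ),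
        ENNReal.ofReal (‖E (Real.log x + b) - E (Real.log x)‖ ^ 2 * x ^ (-(2 * σ + 1))) :=
        mul_le_mul_right (MeasureTheory.lintegral_mono_set fun x hx => hX.trans_le hx.1) _
    _ = ENNReal.ofReal (Y ^ (2 * σ + 1)) * ∫⁻ u : ℝ, ENNReal.ofReal
        (‖E (u + b) - E u‖ ^ 2 * Real.exp (-2 * σ * u)) := by
        rw [lintegral_comp_exp]
        congr 1
        refine MeasureTheory.lintegral_congr fun u => ?_
        rw [← ENNReal.ofReal_mul (Real.exp_pos u).le, Real.log_exp, mul_left_comm,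
          ← Real.exp_mul, ← Real.exp_add]
        ring_nf
    _ ≤ ENNReal.ofReal (Y ^ (2 * σ + 1)) * ENNReal.ofReal (C * b ^ κ) :=
        mul_le_mul_right (hE b hb0 hb2) _
    _ ≤ _ := by
        rw [← ENNReal.ofReal_mul (by positivity)]
        refine ENNReal.ofReal_le_ofReal (mul_le_mul_of_nonneg_left
          (mul_le_mul_of_nonneg_left ?_ hC) (by positivity))
        exact Real.rpow_le_rpow hb0 hbδ hκ

theorem lintegral_additive_shift_le {E : ℝ → ℂ} (hm : Measurable E) {σ C κ : ℝ} (hσ : 0 ≤ σ)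
    (hκ : 0 ≤ κ) (hC : 0 ≤ C)
    (hE : ∀ b : ℝ, 0 ≤ b → b ≤ 2 → ∫⁻ u : ℝ, ENNReal.ofReal
      (‖E (u + b) - E u‖ ^ 2 * Real.exp (-2 * σ * u)) ≤ ENNReal.ofReal (C * b ^ κ))
    {X h : ℝ} (hh : 0 < h) (hhX : h ≤ X) :
    ∫⁻ x in Set.Icc X (2 * X), ENNReal.ofReal
      (‖E (Real.log (x + h)) - E (Real.log x)‖ ^ 2) ≤
      ENNReal.ofReal (36 * ((3 * X) ^ (2 * σ + 1) * (C * (3 * h / X) ^ κ))) := by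
  have hX : 0 < X := hh.trans_le hhX
  have hf : Measurable fun x => E (Real.log x) := hm.comp Real.measurable_log
  set R := (3 * X) ^ (2 * σ + 1) * (C * (3 * h / X) ^ κ) with hR
  have hR0 : 0 ≤ R := by positivity
  have h1 := lintegral_shift_le_average hf hh hhX
  have h2 := lintegral_additive_le_multiplicative hf hX hh
  have hratio : 3 * h / X ≤ 3 := by
    rw [div_le_iff₀ hX]
    linarith
  have h3 : ∫⁻ δ in Set.Icc 0 (3 * h / X), ∫⁻ x in Set.Icc X (3 * X), ENNReal.ofReal
      (‖E (Real.log (x + x * δ)) - E (Real.log x)‖ ^ 2) ≤ ENNReal.ofReal (R * (3 * h / X)) := by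
    calc _ ≤ ∫⁻ _δ in Set.Icc 0 (3 * h / X), ENNReal.ofReal R := by
          refine MeasureTheory.setLIntegral_mono' measurableSet_Icc fun δ hδ => ?_
          refine (lintegral_multiplicative_shift_le hσ hκ hC hE hX (by linarith) hδ.1
            (hδ.2.trans hratio)).trans (ENNReal.ofReal_le_ofReal ?_)
          exact mul_le_mul_of_nonneg_left (mul_le_mul_of_nonneg_left
            (Real.rpow_le_rpow hδ.1 hδ.2 hκ) hC) (by positivity)
      _ = _ := by
          rw [MeasureTheory.setLIntegral_const, Real.volume_Icc, sub_zero,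
            ← ENNReal.ofReal_mul hR0]
  have h4 := h1.trans (mul_le_mul_right (h2.trans (mul_le_mul_right h3 _)) 4)
  rw [← ENNReal.ofReal_mul (by positivity), ← ENNReal.ofReal_ofNat 4,
    ← ENNReal.ofReal_mul (by norm_num),
    -- The length `3h/X` of the range of `δ` cancels `X` and supplies the factor `h` that the
    -- averaging put on the left.
    show 4 * (3 * X * (R * (3 * h / X))) = h * (36 * R) by field_simp; ring,
    ENNReal.ofReal_mul hh.le] at h4
  exact (ENNReal.mul_le_mul_iff_right (by simpa using hh) ENNReal.ofReal_ne_top).1 h4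

/-! ### Return to `divisorError`, and comparison of exponents -/

theorem shortMeanSquare_le_toReal {k : ℕ} {a : ℕ → ℂ} {H : ℂ → ℂ}
    (hH : DifferentiableOn ℂ H {s | 0 < s.re})
    (h : ∀ s : ℂ, 0 < s.re → s ≠ 1 → riemannZeta s ^ k / s =
        ∑ j ∈ Finset.range k, a j / (s - 1) ^ (j + 1) + H s)
    {X t M : ℝ} (hX : 1 ≤ X) (ht : 0 ≤ t) (hM : 0 ≤ M)
    (hle : ∫⁻ x in Set.Icc X (2 * X), ENNReal.ofReal
      (‖divisorRemainder k a (Real.log (x + t)) - divisorRemainder k a (Real.log x)‖ ^ 2) ≤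
        ENNReal.ofReal M) :
    shortMeanSquare k X t ≤ M := by
  -- The cutoff in `divisorRemainder` makes this identity available only for `x ≥ 1`.
  have hD : ∀ x, 1 ≤ x → divisorError k x = (divisorRemainder k a (Real.log x)).re := by
    intro x hx
    rw [← divisorError_exp_eq hH h (Real.log_nonneg hx), Real.exp_log (by linarith)]
  set g : ℝ → ℝ := fun x => ((divisorRemainder k a (Real.log (x + t))).re -
    (divisorRemainder k a (Real.log x)).re) ^ 2 with hg
  have hm := measurable_divisorRemainder k a
  have hm1 : Measurable fun x => divisorRemainder k a (Real.log (x + t)) :=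
    hm.comp (Real.measurable_log.comp (measurable_add_const t))
  have hm2 : Measurable fun x => divisorRemainder k a (Real.log x) := hm.comp Real.measurable_log
  have hgm : Measurable g := by
    have := Complex.measurable_re.comp hm1
    have := Complex.measurable_re.comp hm2
    fun_prop
  have hS : shortMeanSquare k X t = ∫ x in Set.Icc X (2 * X), g x := by
    rw [shortMeanSquare, intervalIntegral.integral_of_le (by linarith),
      ← MeasureTheory.integral_Icc_eq_integral_Ioc]
    refine MeasureTheory.setIntegral_congr_fun measurableSet_Icc fun x hx => ?_
    have h1 : 1 ≤ x := hX.trans hx.1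
    simp only [hg, hD x h1, hD (x + t) (by linarith)]
  rw [hS, MeasureTheory.integral_eq_lintegral_of_nonneg_ae
    (Eventually.of_forall fun x => sq_nonneg _) hgm.aestronglyMeasurable]
  refine ENNReal.toReal_le_of_le_ofReal hM (le_trans (MeasureTheory.lintegral_mono fun x => ?_) hle)
  refine ENNReal.ofReal_le_ofReal ?_
  rw [← Complex.sub_re, ← sq_abs]
  exact pow_le_pow_left₀ (abs_nonneg _) (Complex.abs_re_le_norm _) 2

theorem IsAdmissibleSigma.exists_shortMeanSquare_le {k : ℕ} {σ : ℝ} (hadm : IsAdmissibleSigma k σ)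
    {η : ℝ} (hη : 0 < η) (hη1 : η < 1) :
    ∃ C : ℝ, 0 ≤ C ∧ ∀ X h : ℝ, 1 ≤ h → h ≤ X → shortMeanSquare k X h ≤ C * (X ^ (2 * σ + η) * h) := by
  obtain ⟨a, H, hH, hlaurent⟩ := exists_laurent_expansion_zeta_pow_div k
  obtain ⟨C, hC0, hC⟩ := hadm.exists_lintegral_divisorRemainder_shift_le hH hlaurent hη hη1
  have hσ : 0 ≤ σ := by linarith [hadm.1]
  refine ⟨36 * (3 ^ (2 * σ + 1) * (C * 3 ^ (1 - η))), by positivity, fun X h h1 hhX => ?_⟩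
  have hX : 1 ≤ X := h1.trans hhX
  have hX0 : 0 < X := by linarith
  have hh0 : 0 < h := by linarith
  refine (shortMeanSquare_le_toReal hH hlaurent hX hh0.le (by positivity)
    (lintegral_additive_shift_le (measurable_divisorRemainder k a) hσ (by linarith) hC0 hC hh0
      hhX)).trans ?_
  rw [Real.mul_rpow (by norm_num) hX0.le, mul_div_assoc, Real.mul_rpow (by norm_num)
    (by positivity), Real.div_rpow hh0.le hX0.le]
  -- The second factor cancels the denominator of `(h/X)^{1-η}`.
  have e : X ^ (2 * σ + 1) = X ^ (2 * σ + η) * X ^ (1 - η) := by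
    rw [← Real.rpow_add hX0]
    ring_nf
  have e2 : h ^ (1 - η) ≤ h := by
    simpa using Real.rpow_le_rpow_of_exponent_le h1 (show 1 - η ≤ 1 by linarith)
  have hXp : 0 < X ^ (1 - η) := by positivity
  rw [e]
  calc _ = 36 * (3 ^ (2 * σ + 1) * (C * 3 ^ (1 - η))) * (X ^ (2 * σ + η) * h ^ (1 - η)) := by
        field_simp
    _ ≤ _ := by
        refine mul_le_mul_of_nonneg_left (mul_le_mul_of_nonneg_left e2 ?_) ?_ <;> positivity

theorem theorem1 (k : ℕ) (hk : 3 ≤ k) (σ : ℝ) (hσ : IsAdmissibleSigma k σ) :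
    (σ = 1 / 2 →
      ∀ ε : ℝ, 0 < ε → ∃ C : ℝ, ∀ X h : ℝ, 1 ≤ X → X ^ ε ≤ h → h ≤ X ^ (1 - ε) →
        shortMeanSquare k X h ≤ C * (X ^ (1 + ε) * h ^ (4 / 3 : ℝ))) ∧
    (1 / 2 < σ →
      ∀ θ : ℝ, 2 * σ - 1 < θ → θ < 1 →
        ∃ ε₁ : ℝ, 0 < ε₁ ∧ ∃ C : ℝ, ∀ ε : ℝ, 0 < ε →
          ∀ X h : ℝ, 1 ≤ X → X ^ θ ≤ h → h ≤ X ^ (1 - ε) →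
            shortMeanSquare k X h ≤ C * (X ^ (1 - ε₁) * h ^ 2)) := by
  have hle : ∀ {X ε h : ℝ}, 1 ≤ X → 0 < ε → h ≤ X ^ (1 - ε) → h ≤ X := fun hX hε hh =>
    hh.trans (by simpa using Real.rpow_le_rpow_of_exponent_le hX (show 1 - _ ≤ 1 by linarith))
  refine ⟨fun hhalf ε hε => ?_, fun hhalf θ hθ _ => ?_⟩
  -- The minimum with `1/2` only keeps `η < 1` when `ε` is large.
  · obtain ⟨C, hC0, hC⟩ := hσ.exists_shortMeanSquare_le (η := min ε (1 / 2))
      (lt_min hε (by norm_num)) ((min_le_right _ _).trans_lt (by norm_num))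
    refine ⟨C, fun X h hX h1 h2 => ?_⟩
    have hh1 : 1 ≤ h := (Real.one_le_rpow hX hε.le).trans h1
    refine (hC X h hh1 (hle hX hε h2)).trans (mul_le_mul_of_nonneg_left ?_ hC0)
    refine mul_le_mul (Real.rpow_le_rpow_of_exponent_le hX ?_) ?_ (by linarith) (by positivity)
    · rw [hhalf]
      linarith [min_le_left ε (1 / 2)]
    · simpa using Real.rpow_le_rpow_of_exponent_le hh1 (show (1 : ℝ) ≤ 4 / 3 by norm_num)
  -- Chosen so that `2σ + ε₁ = 1 - ε₁ + θ`: half of the gap pays for `η`, the other half is the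
  -- saving. It does not involve `ε`.
  · set ε₁ := (θ - (2 * σ - 1)) / 2 with hε₁
    have hε₁0 : 0 < ε₁ := by linarith
    obtain ⟨C, hC0, hC⟩ := hσ.exists_shortMeanSquare_le (η := min ε₁ (1 / 2))
      (lt_min hε₁0 (by norm_num)) ((min_le_right _ _).trans_lt (by norm_num))
    refine ⟨ε₁, hε₁0, C, fun ε hε X h hX h1 h2 => ?_⟩
    have hX0 : 0 < X := by linarith
    have hh1 : 1 ≤ h := (Real.one_le_rpow hX (by linarith)).trans h1
    refine (hC X h hh1 (hle hX hε h2)).trans (mul_le_mul_of_nonneg_left ?_ hC0)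
    rw [sq, ← mul_assoc]
    refine mul_le_mul_of_nonneg_right ?_ (by linarith)
    calc X ^ (2 * σ + min ε₁ (1 / 2)) ≤ X ^ (1 - ε₁ + θ) :=
          Real.rpow_le_rpow_of_exponent_le hX (by linarith [min_le_left ε₁ (1 / 2)])
      _ = X ^ (1 - ε₁) * X ^ θ := Real.rpow_add hX0 _ _
      _ ≤ X ^ (1 - ε₁) * h := mul_le_mul_of_nonneg_left h1 (by positivity)
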